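/- Let $\mathsf k$ be a separable complex Hilbert space. For $t>0$ let $\mathsf K_t=L^2([0,t[;\mathsf k)$, regarded as a subspace of $L^2(\mathbb R_+;\mathsf k)$, and let $\mathcal F_t$ be the symmetric Fock space over $\mathsf K_t$, that is, the closed linear span of the exponential vectors $\varepsilon(g)=\big((n!)^{-1/2}g^{\otimes n}\big)_{n\ge 0}$, $g\in\mathsf K_t$, in the full Fock space $\bigoplus_{n\ge0}L^2(\mathbb R_+;\mathsf k)^{\otimes n}$. The spaces $(\mathcal F_t)_{t>0}$ form an Arveson system, the Fock Arveson system $\mathcal F^{\mathsf k}$ over $\mathsf k$, with unitary structure maps $B_{s,t}:\mathcal F_{s+t}\to\mathcal F_s\otimes\mathcal F_t$ determined by $$B_{s,t}\,\varepsilon(h)=\varepsilon(h|_{[0,s[})\otimes\varepsilon\big(h(\cdot+s)|_{[0,t[}\big)\qquad(h\in\mathsf K_{s+t}).$$ Write $x\bullet y\in\mathcal F_{s+t}$ for the preimage of $x\otimes y$ under $B_{s,t}$ ($x\in\mathcal F_s$, $y\in\mathcal F_t$), and let $\Omega=(\varepsilon(0))_{t>0}$ be the vacuum unit. A root of $(\mathcal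 F^{\mathsf k},\Omega)$ is a measurable section $a=(a_t)_{t>0}$, $a_t\in\mathcal F_t$, such that $$a_{s+t}=a_s\bullet\Omega_t+\Omega_s\bullet a_t\quad(s,t>0)\qquad\text{and}\qquad \Omega_t\perp a_t\quad(t>0).$$ The roots form a vector space $R$ (pointwise operations), with inner product $\langle a,b\rangle:=\langle a_1,b_1\rangle_{\mathcal F_1}$. For $c\in\mathsf k$ let $\chi^c=(\chi^c_t)_{t>0}$, where $\chi^c_t\in\mathcal F_t$ is the function $c\,1_{[0,t[}\in\mathsf K_t$, regarded as an element of the one-particle subspace of $\mathcal F_t$. Then each $\chi^c$ is a root of $(\mathcal F^{\mathsf k},\Omega)$, and $c\mapsto\chi^c$ is an isometric linear isomorphism from $\mathsf k$ onto $R$. -/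

import Mathlib

open MeasureTheory UniformSpace
open scoped TensorProduct InnerProductSpace ENNReal

universe u

noncomputable section

set_option linter.unusedSectionVars false

/-! ### Product systems, units, addits and roots -/

/-- The time parameters: strictly positive reals. -/
abbrev PosTime : Type := {t : ℝ // 0 < t}

/-- The Hilbert space tensor product: completion of the algebraic tensor product for the inner
product `⟪x ⊗ y, x' ⊗ y'⟫ = ⟪x, x'⟫ * ⟪y, y'⟫`. -/
abbrev HilbertTensor (X Y : Type*) [NormedAddCommGroup X] [InnerProductSpace ℂ X]
    [NormedAddCommGroup Y] [InnerProductSpace ℂ Y] : Type _ :=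
  Completion (X ⊗[ℂ] Y)

/-- Elementary tensors in the Hilbert space tensor product. -/
def HilbertTensor.tmul {X Y : Type*} [NormedAddCommGroup X] [InnerProductSpace ℂ X]
    [NormedAddCommGroup Y] [InnerProductSpace ℂ Y] (x : X) (y : Y) : HilbertTensor X Y :=
  ((x ⊗ₜ[ℂ] y : X ⊗[ℂ] Y) : Completion (X ⊗[ℂ] Y))

/-- An algebraic product system, with unitary structure maps
`B s t : E (s + t) → E s ⊗ E t`. Writing `x • y` for the preimage of `x ⊗ y` under `B`, the
consistency condition on the structure maps is `(x • y) • z = x • (y • z)`; as these elements live in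
the fibres over `(r + s) + t` and `r + (s + t)`, it is written in the total space. -/
structure ProductSystem where
  E : PosTime → Type u
  [instGroup : ∀ t, NormedAddCommGroup (E t)]
  [instInner : ∀ t, InnerProductSpace ℂ (E t)]
  [instComplete : ∀ t, CompleteSpace (E t)]
  B : ∀ s t : PosTime, E (s + t) ≃ₗᵢ[ℂ] HilbertTensor (E s) (E t)
  consistent : ∀ (r s t : PosTime) (x : E r) (y : E s) (z : E t),
    (⟨r + s + t, (B (r + s) t).symm (.tmul ((B r s).symm (.tmul x y)) z)⟩ : Σ q, E q) =
      ⟨r + (s + t), (B r (s + t)).symm (.tmul x ((B s t).symm (.tmul y z)))⟩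

namespace ProductSystem

attribute [instance] instGroup instInner instComplete

/-- The product `x • y ∈ E (s + t)` of `x ∈ E s` and `y ∈ E t`: the preimage of `x ⊗ y`. -/
def mul (P : ProductSystem.{u}) {s t : PosTime} (x : P.E s) (y : P.E t) : P.E (s + t) :=
  (P.B s t).symm (.tmul x y)

end ProductSystem

/-- An Arveson system: a product system with a measurable structure, given by a sequence of
sections which is total in each fibre and with respect to which the inner products and the
structure maps are measurable. In particular each fibre is separable. -/
structure ArvesonSystem extends ProductSystem.{u} where
  e : ℕ → ∀ t, E t
  total : ∀ t, (Submodule.span ℂ (Set.range fun n => e n t)).topologicalClosure = ⊤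
  measurable_inner : ∀ m n, Measurable fun t : PosTime => ⟪e m t, e n t⟫_ℂ
  measurable_B : ∀ l m n, Measurable fun p : PosTime × PosTime =>
    ⟪HilbertTensor.tmul (e m p.1) (e n p.2), B p.1 p.2 (e l (p.1 + p.2))⟫_ℂ

namespace ArvesonSystem

/-- Measurability of a section. -/
def IsMeasurableSection (A : ArvesonSystem.{u}) (x : ∀ t, A.E t) : Prop :=
  ∀ n, Measurable fun t : PosTime => ⟪A.e n t, x t⟫_ℂ

/-- Units: nonzero measurable sections with `u (s + t) = u s • u t`. -/
structure IsUnit (A : ArvesonSystem.{u}) (u : ∀ t, A.E t) : Prop where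
  measurable : A.IsMeasurableSection u
  ne_zero : u ≠ 0
  mul : ∀ s t, u (s + t) = A.mul (u s) (u t)

/-- Addits of `(A, u)`. -/
structure IsAddit (A : ArvesonSystem.{u}) (u a : ∀ t, A.E t) : Prop where
  measurable : A.IsMeasurableSection a
  add : ∀ s t, a (s + t) = A.mul (a s) (u t) + A.mul (u s) (a t)

/-- Roots of `(A, u)`: addits `a` with `u t ⟂ a t` for all `t`. -/
structure IsRoot (A : ArvesonSystem.{u}) (u a : ∀ t, A.E t) : Prop extends A.IsAddit u a where
  orthogonal : ∀ t, ⟪u t, a t⟫_ℂ = 0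

end ArvesonSystem

/-- A pointed Arveson system: an Arveson system with a fixed normalised unit. -/
structure PointedArvesonSystem extends ArvesonSystem.{u} where
  unit : ∀ t, E t
  isUnit : toArvesonSystem.IsUnit unit
  norm_unit : ∀ t, ‖unit t‖ = 1

section tensor
variable {X Y : Type*} [NormedAddCommGroup X] [InnerProductSpace ℂ X]
    [NormedAddCommGroup Y] [InnerProductSpace ℂ Y]

namespace HilbertTensor

theorem tmul_add (x : X) (y y' : Y) : tmul x (y + y') = tmul x y + tmul x y' := by
  simp [tmul, TensorProduct.tmul_add, Completion.coe_add]

theorem add_tmul (x x' : X) (y : Y) : tmul (x + x') y = tmul x y + tmul x' y := by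
  simp [tmul, TensorProduct.add_tmul, Completion.coe_add]

theorem tmul_smul (c : ℂ) (x : X) (y : Y) : tmul x (c • y) = c • tmul x y := by
  simp [tmul, TensorProduct.tmul_smul, Completion.coe_smul]

theorem smul_tmul (c : ℂ) (x : X) (y : Y) : tmul (c • x) y = c • tmul x y := by
  rw [tmul, tmul, ← Completion.coe_smul, TensorProduct.smul_tmul']

theorem inner_tmul (x x' : X) (y y' : Y) :
    ⟪tmul x y, tmul x' y'⟫_ℂ = ⟪x, x'⟫_ℂ * ⟪y, y'⟫_ℂ := by
  simp [tmul, Completion.inner_coe]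

theorem norm_tmul (x : X) (y : Y) : ‖tmul x y‖ = ‖x‖ * ‖y‖ := by
  simp [tmul]

/-- `tmul x` as a continuous linear map. -/
def tmulR (x : X) : Y →L[ℂ] HilbertTensor X Y :=
  LinearMap.mkContinuous
    { toFun := tmul x, map_add' := tmul_add x, map_smul' := fun c y => tmul_smul c x y } ‖x‖
    fun y => (norm_tmul x y).le

/-- `tmul · y` as a continuous linear map. -/
def tmulL (y : Y) : X →L[ℂ] HilbertTensor X Y :=
  LinearMap.mkContinuous
    { toFun := fun x => tmul x y, map_add' := fun x x' => add_tmul x x' y,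
      map_smul' := fun c x => smul_tmul c x y } ‖y‖
    fun x => ((norm_tmul x y).trans (mul_comm _ _)).le

/-- Tensors of total families are total. -/
theorem tmul_total {ι κ : Type*} {v : ι → X} {w : κ → Y}
    (hv : (Submodule.span ℂ (Set.range v)).topologicalClosure = ⊤)
    (hw : (Submodule.span ℂ (Set.range w)).topologicalClosure = ⊤) :
    (Submodule.span ℂ (Set.range fun p : ι × κ => tmul (v p.1) (w p.2))).topologicalClosure = ⊤ := by
  set M := (Submodule.span ℂ (Set.range fun p : ι × κ =>
      tmul (v p.1) (w p.2))).topologicalClosure with hM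
  have hMc : IsClosed (M : Set (HilbertTensor X Y)) := Submodule.isClosed_topologicalClosure _
  have step1 : ∀ (i : ι) (y : Y), tmul (v i) y ∈ M := by
    intro i y
    have hle : Submodule.span ℂ (Set.range w) ≤ M.comap (tmulR (v i)).toLinearMap := by
      rw [Submodule.span_le]
      rintro _ ⟨j, rfl⟩
      exact Submodule.le_topologicalClosure _ (Submodule.subset_span ⟨(i, j), rfl⟩)
    have := Submodule.topologicalClosure_minimal _ hle (hMc.preimage (tmulR (v i)).continuous)
    rw [hw] at this
    exact this (Submodule.mem_top : y ∈ ⊤)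
  have step2 : ∀ (x : X) (y : Y), tmul x y ∈ M := by
    intro x y
    have hle : Submodule.span ℂ (Set.range v) ≤ M.comap (tmulL y).toLinearMap := by
      rw [Submodule.span_le]
      rintro _ ⟨i, rfl⟩
      exact step1 i y
    have := Submodule.topologicalClosure_minimal _ hle (hMc.preimage (tmulL y).continuous)
    rw [hv] at this
    exact this (Submodule.mem_top : x ∈ ⊤)
  rw [eq_top_iff]
  intro z _
  refine Completion.induction_on z hMc fun w => ?_
  induction w using TensorProduct.induction_on with
  | zero => exact M.zero_mem
  | tmul x y => exact step2 x y
  | add x y hx hy =>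
    rw [Completion.coe_add]
    exact M.add_mem hx hy

end HilbertTensor
end tensor

namespace ProductSystem
variable (P : ProductSystem.{u}) {s t : PosTime}

theorem mul_add (x : P.E s) (y y' : P.E t) : P.mul x (y + y') = P.mul x y + P.mul x y' := by
  simp [mul, HilbertTensor.tmul_add]

theorem add_mul (x x' : P.E s) (y : P.E t) : P.mul (x + x') y = P.mul x y + P.mul x' y := by
  simp [mul, HilbertTensor.add_tmul]

theorem mul_smul (c : ℂ) (x : P.E s) (y : P.E t) : P.mul x (c • y) = c • P.mul x y := by
  simp [mul, HilbertTensor.tmul_smul]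

theorem smul_mul (c : ℂ) (x : P.E s) (y : P.E t) : P.mul (c • x) y = c • P.mul x y := by
  simp [mul, HilbertTensor.smul_tmul]

theorem inner_mul (x x' : P.E s) (y y' : P.E t) :
    ⟪P.mul x y, P.mul x' y'⟫_ℂ = ⟪x, x'⟫_ℂ * ⟪y, y'⟫_ℂ := by
  simp [mul, HilbertTensor.inner_tmul]

end ProductSystem

namespace PointedArvesonSystem

/-- The vector space of roots of a pointed Arveson system, as a subspace of the space of sections. -/
def rootSubmodule (A : PointedArvesonSystem.{u}) : Submodule ℂ (∀ t, A.E t) where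
  carrier := {a | A.IsRoot A.unit a}
  zero_mem' :=
    { measurable := fun n => by simp
      add := fun s t => by
        have h1 := A.smul_mul (0 : ℂ) (0 : A.E s) (A.unit t)
        have h2 := A.mul_smul (0 : ℂ) (A.unit s) (0 : A.E t)
        simp only [zero_smul] at h1 h2
        simp [h1, h2]
      orthogonal := fun t => by simp }
  add_mem' {a b} ha hb :=
    { measurable := fun n => by
        simp only [Pi.add_apply, inner_add_right]
        exact (ha.measurable n).add (hb.measurable n)
      add := fun s t => by
        simp only [Pi.add_apply, ha.add s t, hb.add s t, A.add_mul, A.mul_add]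
        abel
      orthogonal := fun t => by
        simp [ha.orthogonal t, hb.orthogonal t] }
  smul_mem' c a ha :=
    { measurable := fun n => by
        simpa [inner_smul_right] using (ha.measurable n).const_mul c
      add := fun s t => by
        simp only [Pi.smul_apply, ha.add s t, A.smul_mul, A.mul_smul, smul_add]
      orthogonal := fun t => by
        simp [ha.orthogonal t] }

/-- The space of roots of a pointed Arveson system. -/
def Root (A : PointedArvesonSystem.{u}) : Type u := A.rootSubmodule

namespace Root
variable {A : PointedArvesonSystem.{u}}

instance : AddCommGroup A.Root := inferInstanceAs (AddCommGroup A.rootSubmodule)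
instance : Module ℂ A.Root := inferInstanceAs (Module ℂ A.rootSubmodule)

instance : CoeFun A.Root (fun _ => ∀ t, A.E t) := ⟨fun a => a.1⟩

theorem isRoot (a : A.Root) : A.IsRoot A.unit a := a.2

theorem norm_sq_add (a : A.Root) (s t : PosTime) :
    ‖a (s + t)‖ ^ 2 = ‖a s‖ ^ 2 + ‖a t‖ ^ 2 := by
  have hu : ∀ t, ⟪A.unit t, A.unit t⟫_ℂ = 1 := fun t => by
    rw [inner_self_eq_norm_sq_to_K, A.norm_unit t]; simp
  have ho : ∀ t, ⟪a t, A.unit t⟫_ℂ = 0 := fun t => by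
    rw [← inner_conj_symm, a.isRoot.orthogonal t]; simp
  have h : ⟪a (s + t), a (s + t)⟫_ℂ = ⟪a s, a s⟫_ℂ + ⟪a t, a t⟫_ℂ := by
    rw [a.isRoot.add s t]
    simp only [inner_add_left, inner_add_right, A.inner_mul, hu, ho, a.isRoot.orthogonal]
    ring
  simp only [inner_self_eq_norm_sq_to_K] at h
  exact_mod_cast h

/-- A root which vanishes at time `1` is zero. -/
theorem eq_zero_of_apply_one (a : A.Root) (h : a ⟨1, one_pos⟩ = 0) : a = 0 := by
  have nat : ∀ (n : ℕ) (t : PosTime), ‖a ⟨(n + 1 : ℝ) * t.1, by have := t.2; positivity⟩‖ ^ 2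
      = (n + 1 : ℝ) * ‖a t‖ ^ 2 := by
    intro n t
    induction n with
    | zero =>
      have : (⟨((0 : ℕ) + 1 : ℝ) * t.1, by have := t.2; positivity⟩ : PosTime) = t :=
        Subtype.ext (by simp)
      rw [this]
      simp
    | succ n ih =>
      have : (⟨((n + 1 : ℕ) + 1 : ℝ) * t.1, by have := t.2; positivity⟩ : PosTime) =
          ⟨(n + 1 : ℝ) * t.1, by have := t.2; positivity⟩ + t := by
        apply Subtype.ext
        rw [Positive.coe_add]
        push_cast
        ring
      rw [this, norm_sq_add, ih]
      push_cast
      ring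
  have small : ∀ t : PosTime, t.1 < 1 → ‖a t‖ ^ 2 = 0 := by
    intro t ht
    have h1 : (⟨1, one_pos⟩ : PosTime) = t + ⟨1 - t.1, by linarith⟩ := by
      apply Subtype.ext
      simp [Positive.coe_add]
    have := norm_sq_add a t ⟨1 - t.1, by linarith⟩
    rw [← h1, h] at this
    simp only [norm_zero] at this
    nlinarith [sq_nonneg ‖a t‖, sq_nonneg ‖a ⟨1 - t.1, by linarith⟩‖]
  apply Subtype.ext
  funext t
  obtain ⟨n, hn⟩ := exists_nat_gt t.1
  have ht := t.2
  have hpos : (0 : ℝ) < n + 1 := by positivity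
  have hs : t.1 / (n + 1) < 1 := by
    rw [div_lt_one hpos]; linarith
  have e := nat n ⟨t.1 / (n + 1), by positivity⟩
  rw [small ⟨t.1 / (n + 1), by positivity⟩ hs, mul_zero] at e
  have ht' : (⟨(n + 1 : ℝ) * (t.1 / (n + 1)), by positivity⟩ : PosTime) = t := by
    apply Subtype.ext
    field_simp
  rw [ht'] at e
  exact norm_eq_zero.mp (pow_eq_zero_iff (two_ne_zero) |>.mp e)

/-- The inner product `⟪a, b⟫ = ⟪a 1, b 1⟫` on the space of roots. -/
@[reducible]
def core : InnerProductSpace.Core ℂ A.Root where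
  inner a b := ⟪a ⟨1, one_pos⟩, b ⟨1, one_pos⟩⟫_ℂ
  conj_inner_symm _ _ := inner_conj_symm _ _
  re_inner_nonneg _ := inner_self_nonneg
  add_left a b _ := inner_add_left (a ⟨1, one_pos⟩) (b ⟨1, one_pos⟩) _
  smul_left a b r := inner_smul_left (a ⟨1, one_pos⟩) (b ⟨1, one_pos⟩) r
  definite a h := eq_zero_of_apply_one a (inner_self_eq_zero.mp h)

instance : NormedAddCommGroup A.Root := core.toNormedAddCommGroup
instance : InnerProductSpace ℂ A.Root := InnerProductSpace.ofCore core.toCore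

theorem inner_def (a b : A.Root) : ⟪a, b⟫_ℂ = ⟪a ⟨1, one_pos⟩, b ⟨1, one_pos⟩⟫_ℂ := rfl

end Root
end PointedArvesonSystem

/-! ### Fock space -/

section gram
variable {ι X Z : Type*} [NormedAddCommGroup X] [InnerProductSpace ℂ X]
  [NormedAddCommGroup Z] [InnerProductSpace ℂ Z]

theorem norm_linearCombination_eq_of_gram {v : ι → X} {w : ι → Z}
    (h : ∀ i j, ⟪w i, w j⟫_ℂ = ⟪v i, v j⟫_ℂ) (c : ι →₀ ℂ) :
    ‖Finsupp.linearCombination ℂ w c‖ = ‖Finsupp.linearCombination ℂ v c‖ := by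
  have : ⟪Finsupp.linearCombination ℂ w c, Finsupp.linearCombination ℂ w c⟫_ℂ =
      ⟪Finsupp.linearCombination ℂ v c, Finsupp.linearCombination ℂ v c⟫_ℂ := by
    simp only [Finsupp.linearCombination_apply, Finsupp.sum, sum_inner, inner_sum,
      inner_smul_left, inner_smul_right, h]
  rw [@norm_eq_sqrt_re_inner ℂ, this, ← @norm_eq_sqrt_re_inner ℂ]

theorem eq_of_total {v : ι → X} (hv : (Submodule.span ℂ (Set.range v)).topologicalClosure = ⊤)
    (A B : X →L[ℂ] Z) (h : ∀ i, A (v i) = B (v i)) (x : X) : A x = B x := by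
  have hle : Submodule.span ℂ (Set.range v) ≤ LinearMap.eqLocus A.toLinearMap B.toLinearMap := by
    rw [Submodule.span_le]
    rintro _ ⟨i, rfl⟩
    exact h i
  have := Submodule.topologicalClosure_minimal _ hle (isClosed_eq A.continuous B.continuous)
  rw [hv] at this
  exact this (Submodule.mem_top : x ∈ ⊤)

/-- Two families with the same Gram matrix, the first one total: the isometry taking the first to
the second. -/
def gramIsometry [CompleteSpace Z] (v : ι → X) (w : ι → Z)
    (hv : (Submodule.span ℂ (Set.range v)).topologicalClosure = ⊤)
    (h : ∀ i j, ⟪w i, w j⟫_ℂ = ⟪v i, v j⟫_ℂ) : X →ₗᵢ[ℂ] Z where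
  toLinearMap := (Finsupp.linearCombination ℂ w).extendOfNorm (Finsupp.linearCombination ℂ v)
  norm_map' := by
    have hd : DenseRange (Finsupp.linearCombination ℂ v) := by
      rw [DenseRange, ← LinearMap.coe_range, Finsupp.range_linearCombination,
        Submodule.dense_iff_topologicalClosure_eq_top]
      exact hv
    intro x
    refine hd.induction (P := fun x => ‖((Finsupp.linearCombination ℂ w).extendOfNorm
      (Finsupp.linearCombination ℂ v)) x‖ = ‖x‖) ?_
      (isClosed_eq (by fun_prop) (by fun_prop)) x
    rintro _ ⟨c, rfl⟩
    rw [LinearMap.extendOfNorm_eq hd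
      ⟨1, fun c => by rw [one_mul, norm_linearCombination_eq_of_gram h]⟩]
    exact norm_linearCombination_eq_of_gram h c

theorem gramIsometry_apply [CompleteSpace Z] (v : ι → X) (w : ι → Z)
    (hv : (Submodule.span ℂ (Set.range v)).topologicalClosure = ⊤)
    (h : ∀ i j, ⟪w i, w j⟫_ℂ = ⟪v i, v j⟫_ℂ) (i : ι) : gramIsometry v w hv h (v i) = w i := by
  have hd : DenseRange (Finsupp.linearCombination ℂ v) := by
    rw [DenseRange, ← LinearMap.coe_range, Finsupp.range_linearCombination,
      Submodule.dense_iff_topologicalClosure_eq_top]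
    exact hv
  have := LinearMap.extendOfNorm_eq (f := Finsupp.linearCombination ℂ w) hd
    ⟨1, fun c => by rw [one_mul, norm_linearCombination_eq_of_gram h]⟩ (Finsupp.single i 1)
  rw [Finsupp.linearCombination_single, Finsupp.linearCombination_single, one_smul, one_smul] at this
  exact this

/-- If both families are total, the isometry is unitary. -/
def gramUnitary [CompleteSpace X] [CompleteSpace Z] (v : ι → X) (w : ι → Z)
    (hv : (Submodule.span ℂ (Set.range v)).topologicalClosure = ⊤)
    (hw : (Submodule.span ℂ (Set.range w)).topologicalClosure = ⊤)
    (h : ∀ i j, ⟪w i, w j⟫_ℂ = ⟪v i, v j⟫_ℂ) : X ≃ₗᵢ[ℂ] Z :=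
  LinearIsometryEquiv.ofSurjective (gramIsometry v w hv h) (by
    have hcl : IsClosed (Set.range (gramIsometry v w hv h)) :=
      (gramIsometry v w hv h).isometry.isClosedEmbedding.isClosed_range
    have hle : Submodule.span ℂ (Set.range w) ≤
        LinearMap.range (gramIsometry v w hv h).toLinearMap := by
      rw [Submodule.span_le]
      rintro _ ⟨i, rfl⟩
      exact ⟨v i, gramIsometry_apply v w hv h i⟩
    have := Submodule.topologicalClosure_minimal _ hle hcl
    rw [hw] at this
    intro z
    exact this (Submodule.mem_top : z ∈ ⊤))

theorem gramUnitary_apply [CompleteSpace X] [CompleteSpace Z] (v : ι → X) (w : ι → Z)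
    (hv : (Submodule.span ℂ (Set.range v)).topologicalClosure = ⊤)
    (hw : (Submodule.span ℂ (Set.range w)).topologicalClosure = ⊤)
    (h : ∀ i j, ⟪w i, w j⟫_ℂ = ⟪v i, v j⟫_ℂ) (i : ι) : gramUnitary v w hv hw h (v i) = w i :=
  gramIsometry_apply v w hv h i

end gram

/-- The scalars, lifted to a universe, as a one-dimensional Hilbert space. -/
instance ULift.innerProductSpaceComplex : InnerProductSpace ℂ (ULift.{u} ℂ) where
  inner x y := ⟪x.down, y.down⟫_ℂ
  norm_sq_eq_re_inner x := norm_sq_eq_re_inner x.down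
  conj_inner_symm x y := inner_conj_symm x.down y.down
  add_left x y z := inner_add_left x.down y.down z.down
  smul_left x y r := inner_smul_left x.down y.down r

/-- An inner product space as a bundled object, for the recursion defining tensor powers. -/
structure BundledInner where
  carrier : Type u
  [instGroup : NormedAddCommGroup carrier]
  [instInner : InnerProductSpace ℂ carrier]

attribute [instance] BundledInner.instGroup BundledInner.instInner

section Fock
variable (H : Type u) [NormedAddCommGroup H] [InnerProductSpace ℂ H]

/-- The algebraic tensor powers of `H`, with their inner products: `H^⊗0 = ℂ` and
`H^⊗(n+1) = H ⊗ H^⊗n`. -/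
def algPow : ℕ → BundledInner.{u}
  | 0 => ⟨ULift.{u} ℂ⟩
  | n + 1 => ⟨H ⊗[ℂ] (algPow n).carrier⟩

/-- The Hilbert space tensor power `H^⊗n`. -/
abbrev HilbertPow (n : ℕ) : Type u := Completion (algPow H n).carrier

/-- The full Fock space: the Hilbert space direct sum of the tensor powers of `H`. -/
abbrev FullFock : Type u := lp (HilbertPow H) 2

variable {H}

/-- `h ⊗ ⋯ ⊗ h` in the algebraic tensor power. -/
def algPowVec (h : H) : ∀ n, (algPow H n).carrier
  | 0 => (ULift.up 1 : ULift.{u} ℂ)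
  | n + 1 => (h ⊗ₜ[ℂ] algPowVec h n : H ⊗[ℂ] (algPow H n).carrier)

/-- `h^⊗n` in the Hilbert space tensor power. -/
def powVec (h : H) (n : ℕ) : HilbertPow H n := (algPowVec h n : Completion (algPow H n).carrier)

theorem inner_algPowVec (g h : H) : ∀ n, ⟪algPowVec g n, algPowVec h n⟫_ℂ = ⟪g, h⟫_ℂ ^ n
  | 0 => by
    change ⟪(1 : ℂ), (1 : ℂ)⟫_ℂ = _
    simp
  | n + 1 => by
    change ⟪(g ⊗ₜ[ℂ] algPowVec g n : H ⊗[ℂ] (algPow H n).carrier), h ⊗ₜ[ℂ] algPowVec h n⟫_ℂ = _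
    rw [TensorProduct.inner_tmul, inner_algPowVec g h n, pow_succ']

theorem inner_powVec (g h : H) (n : ℕ) : ⟪powVec g n, powVec h n⟫_ℂ = ⟪g, h⟫_ℂ ^ n := by
  rw [powVec, powVec, Completion.inner_coe, inner_algPowVec]

theorem norm_powVec (h : H) (n : ℕ) : ‖powVec h n‖ = ‖h‖ ^ n := by
  have := inner_powVec h h n
  rw [inner_self_eq_norm_sq_to_K, inner_self_eq_norm_sq_to_K] at this
  have h2 : ‖powVec h n‖ ^ 2 = (‖h‖ ^ n) ^ 2 := by
    rw [← pow_mul, mul_comm, pow_mul]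
    exact_mod_cast this
  exact (sq_eq_sq₀ (norm_nonneg _) (by positivity)).mp h2

/-- The coefficients `(n!)^(-1/2) h^⊗n` of an exponential vector. -/
def expCoeff (h : H) (n : ℕ) : HilbertPow H n :=
  (((Real.sqrt (n.factorial : ℝ))⁻¹ : ℝ) : ℂ) • powVec h n

theorem norm_expCoeff_sq (h : H) (n : ℕ) :
    ‖expCoeff h n‖ ^ 2 = (‖h‖ ^ 2) ^ n / n.factorial := by
  rw [expCoeff, norm_smul, norm_powVec, mul_pow, Complex.norm_real, Real.norm_eq_abs, sq_abs,
    inv_pow, Real.sq_sqrt (by positivity), ← pow_mul, ← pow_mul, mul_comm 2 n]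
  field_simp

theorem memℓp_expCoeff (h : H) : Memℓp (expCoeff h) 2 := by
  rw [memℓp_gen_iff (by norm_num)]
  have : ∀ n, ‖expCoeff h n‖ ^ (2 : ℝ≥0∞).toReal = (‖h‖ ^ 2) ^ n / n.factorial := fun n => by
    rw [← norm_expCoeff_sq]; simp
  simp_rw [this]
  exact Real.summable_pow_div_factorial _

/-- The exponential vector `ε(h) = ((n!)^(-1/2) h^⊗n)_n`. -/
def expVec (h : H) : FullFock H := ⟨expCoeff h, memℓp_expCoeff h⟩

/-- The inclusion of the one-particle space. -/
def oneParticle (h : H) : FullFock H := lp.single 2 1 (powVec h 1)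

theorem inner_expVec (g h : H) : ⟪expVec g, expVec h⟫_ℂ = Complex.exp ⟪g, h⟫_ℂ := by
  rw [lp.inner_eq_tsum, Complex.exp_eq_exp_ℂ, NormedSpace.exp_eq_tsum_div]
  refine tsum_congr fun n => ?_
  change ⟪expCoeff g n, expCoeff h n⟫_ℂ = _
  rw [expCoeff, expCoeff, inner_smul_left, inner_smul_right, inner_powVec, Complex.conj_ofReal,
    ← mul_assoc, ← Complex.ofReal_mul, ← mul_inv, Real.mul_self_sqrt (by positivity)]
  push_cast
  field_simp

theorem inner_expVec_oneParticle (g h : H) : ⟪expVec g, oneParticle h⟫_ℂ = ⟪g, h⟫_ℂ := by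
  rw [oneParticle, lp.inner_single_right]
  change ⟪expCoeff g 1, _⟫_ℂ = _
  simp [expCoeff, inner_powVec]

theorem norm_oneParticle (h : H) : ‖oneParticle h‖ = ‖h‖ := by
  rw [oneParticle, lp.norm_single (by norm_num), norm_powVec, pow_one]

theorem continuous_expVec : Continuous (expVec : H → FullFock H) := by
  rw [continuous_iff_continuousAt]
  intro g
  rw [ContinuousAt, tendsto_iff_norm_sub_tendsto_zero]
  have key : ∀ h : H, ‖expVec h - expVec g‖ = Real.sqrt
      (RCLike.re (Complex.exp ⟪h, h⟫_ℂ - Complex.exp ⟪h, g⟫_ℂ - Complex.exp ⟪g, h⟫_ℂ +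
        Complex.exp ⟪g, g⟫_ℂ)) := by
    intro h
    rw [@norm_eq_sqrt_re_inner ℂ, inner_sub_left, inner_sub_right, inner_sub_right]
    simp only [inner_expVec]
    congr 2
    ring
  simp_rw [key]
  have : Continuous fun h : H => Real.sqrt
      (RCLike.re (Complex.exp ⟪h, h⟫_ℂ - Complex.exp ⟪h, g⟫_ℂ - Complex.exp ⟪g, h⟫_ℂ +
        Complex.exp ⟪g, g⟫_ℂ)) := by fun_prop
  simpa using this.tendsto g

/-- The one-particle vector of `h` is the derivative at `0` of `z ↦ ε(z h)`. -/
theorem oneParticle_mem (K : Submodule ℂ H) {h : H} (hh : h ∈ K) :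
    oneParticle h ∈ (Submodule.span ℂ (expVec '' (K : Set H))).topologicalClosure := by
  set M := Submodule.span ℂ (expVec '' (K : Set H))
  have hmem : ∀ z : ℝ, ((z : ℂ)⁻¹) • (expVec ((z : ℂ) • h) - expVec 0) ∈ M := fun z =>
    M.smul_mem _ (M.sub_mem (Submodule.subset_span ⟨_, K.smul_mem _ hh, rfl⟩)
      (Submodule.subset_span ⟨_, K.zero_mem, rfl⟩))
  have key : ∀ z : ℝ, z ≠ 0 → ‖((z : ℂ)⁻¹) • (expVec ((z : ℂ) • h) - expVec 0) - oneParticle h‖ ^ 2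
      = (Real.exp (z ^ 2 * ‖h‖ ^ 2) - 1) / z ^ 2 - ‖h‖ ^ 2 := by
    intro z hz
    rw [@norm_sub_sq ℂ, norm_oneParticle, inner_smul_left, inner_sub_left,
      inner_expVec_oneParticle, inner_expVec_oneParticle, inner_smul_left, norm_smul, mul_pow,
      @norm_sub_sq ℂ, inner_expVec]
    have e : ∀ g : H, ‖expVec g‖ ^ 2 = Real.exp (‖g‖ ^ 2) := fun g => by
      have := inner_expVec g g
      rw [inner_self_eq_norm_sq_to_K, inner_self_eq_norm_sq_to_K] at this
      apply Complex.ofReal_injective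
      rw [Complex.ofReal_exp]
      push_cast
      exact this
    rw [e, e]
    have hz' : (z : ℂ) ≠ 0 := by exact_mod_cast hz
    simp only [inner_zero_left, inner_zero_right, Complex.exp_zero, sub_zero, map_inv₀,
      Complex.conj_ofReal, norm_inv, Complex.norm_real, norm_smul, mul_pow, Real.norm_eq_abs,
      sq_abs, inv_pow, norm_zero]
    rw [← mul_assoc, inv_mul_cancel₀ hz', one_mul, inner_self_eq_norm_sq_to_K]
    have : RCLike.re (((‖h‖ : ℂ)) ^ 2) = ‖h‖ ^ 2 := by
      norm_cast
    simp
    norm_cast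
    field_simp
    ring
  rw [← SetLike.mem_coe, Submodule.topologicalClosure_coe]
  have hlim : Filter.Tendsto (fun z : ℝ => (Real.exp (z ^ 2 * ‖h‖ ^ 2) - 1) / z ^ 2 - ‖h‖ ^ 2)
      (nhdsWithin 0 {0}ᶜ) (nhds 0) := by
    have hb : Filter.Tendsto (fun z : ℝ => z ^ 2 * (‖h‖ ^ 2) ^ 2) (nhdsWithin 0 {0}ᶜ) (nhds 0) := by
      have : Continuous fun z : ℝ => z ^ 2 * (‖h‖ ^ 2) ^ 2 := by fun_prop
      simpa using (this.tendsto 0).mono_left nhdsWithin_le_nhds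
    have hs : ∀ᶠ z : ℝ in nhdsWithin 0 {0}ᶜ, |z ^ 2 * ‖h‖ ^ 2| ≤ 1 := by
      have : Continuous fun z : ℝ => |z ^ 2 * ‖h‖ ^ 2| := by fun_prop
      have h0 := (this.tendsto 0).mono_left (nhdsWithin_le_nhds (s := {0}ᶜ))
      exact h0.eventually (Iic_mem_nhds (by simp))
    refine squeeze_zero_norm' ?_ hb
    filter_upwards [hs, self_mem_nhdsWithin] with z hz1 hz0
    have hz2 : z ≠ 0 := hz0
    have hz : 0 < z ^ 2 := by positivity
    have hq := Real.abs_exp_sub_one_sub_id_le hz1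
    have e : (Real.exp (z ^ 2 * ‖h‖ ^ 2) - 1) / z ^ 2 - ‖h‖ ^ 2 =
        (Real.exp (z ^ 2 * ‖h‖ ^ 2) - 1 - z ^ 2 * ‖h‖ ^ 2) / z ^ 2 := by
      field_simp
    rw [e, Real.norm_eq_abs, abs_div, abs_of_pos hz, div_le_iff₀ hz]
    calc _ ≤ _ := hq
      _ = _ := by ring
  refine mem_closure_of_tendsto (f := fun z : ℝ => ((z : ℂ)⁻¹) • (expVec ((z : ℂ) • h) - expVec 0))
    (b := nhdsWithin 0 {0}ᶜ) ?_ (Filter.Eventually.of_forall hmem)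
  rw [tendsto_iff_norm_sub_tendsto_zero]
  have h2 : Filter.Tendsto
      (fun z : ℝ => ‖((z : ℂ)⁻¹) • (expVec ((z : ℂ) • h) - expVec 0) - oneParticle h‖ ^ 2)
      (nhdsWithin 0 {0}ᶜ) (nhds 0) := by
    refine hlim.congr' ?_
    filter_upwards [self_mem_nhdsWithin] with z hz
    exact (key z hz).symm
  have := h2.sqrt
  simpa using this

end Fock

/-! ### The Fock Arveson system -/

section FockSystem
variable (k : Type u) [NormedAddCommGroup k] [InnerProductSpace ℂ k]

/-- `L²(ℝ; k)`. The space `L²(ℝ₊; k)` is its subspace of functions vanishing a.e. on the negative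
half-line. -/
abbrev LTwo : Type u := Lp k 2 (volume : Measure ℝ)

/-- `L²([0, t[; k)`: the elements of `L²` vanishing a.e. outside `[0, t[`. -/
def LTwoIco (t : ℝ) : Submodule ℂ (LTwo k) where
  carrier := {g | ∀ᵐ x, x ∉ Set.Ico 0 t → g x = 0}
  zero_mem' := by
    filter_upwards [Lp.coeFn_zero k 2 (volume : Measure ℝ)] with x hx _
    exact hx
  add_mem' {f g} hf hg := by
    filter_upwards [hf, hg, Lp.coeFn_add f g] with x h1 h2 h3 hx
    rw [h3, Pi.add_apply, h1 hx, h2 hx, add_zero]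
  smul_mem' c f hf := by
    filter_upwards [hf, Lp.coeFn_smul c f] with x h1 h2 hx
    rw [h2, Pi.smul_apply, h1 hx, smul_zero]

/-- The closed linear span of the exponential vectors `ε(g)`, for `g` in `L²([0, t[; k)`. -/
def fockSubspace (t : ℝ) : Submodule ℂ (FullFock (LTwo k)) :=
  (Submodule.span ℂ (expVec '' (LTwoIco k t : Set (LTwo k)))).topologicalClosure

/-- The fibre at time `t` of the Fock Arveson system: the symmetric Fock space over
`L²([0, t[; k)`, that is the closed linear span of its exponential vectors. -/
def FockFibre (t : ℝ) : Type u := fockSubspace k t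

instance (t : ℝ) : NormedAddCommGroup (FockFibre k t) :=
  inferInstanceAs (NormedAddCommGroup (fockSubspace k t))
instance (t : ℝ) : InnerProductSpace ℂ (FockFibre k t) :=
  inferInstanceAs (InnerProductSpace ℂ (fockSubspace k t))
instance (t : ℝ) : CompleteSpace (FockFibre k t) :=
  inferInstanceAs (CompleteSpace
    (Submodule.span ℂ (expVec '' (LTwoIco k t : Set (LTwo k)))).topologicalClosure)

/-- The inclusion of the fibre in Fock space. -/
def FockFibre.incl (t : ℝ) : FockFibre k t →ₗᵢ[ℂ] FullFock (LTwo k) := (fockSubspace k t).subtypeₗᵢ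

variable {k}

theorem mem_LTwoIco {t : ℝ} {g : LTwo k} :
    g ∈ LTwoIco k t ↔ ∀ᵐ x, x ∉ Set.Ico 0 t → g x = 0 := Iff.rfl

/-- The exponential vector of `g ∈ L²([0, t[; k)` as an element of the fibre at time `t`. -/
def fockExp {t : ℝ} (g : LTwoIco k t) : FockFibre k t :=
  ⟨expVec (g : LTwo k),
    Submodule.le_topologicalClosure _ (Submodule.subset_span ⟨g, g.2, rfl⟩)⟩

/-- The one-particle vector of `g ∈ L²([0, t[; k)` as an element of the fibre at time `t`. -/
def fockOne {t : ℝ} (g : LTwoIco k t) : FockFibre k t :=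
  ⟨oneParticle (g : LTwo k), oneParticle_mem _ g.2⟩

theorem incl_fockExp {t : ℝ} (g : LTwoIco k t) :
    FockFibre.incl k t (fockExp g) = expVec (g : LTwo k) := rfl

theorem inner_fockExp {t : ℝ} (f g : LTwoIco k t) :
    ⟪fockExp f, fockExp g⟫_ℂ = Complex.exp ⟪(f : LTwo k), (g : LTwo k)⟫_ℂ :=
  inner_expVec _ _

theorem continuous_fockExp {t : ℝ} : Continuous (fockExp : LTwoIco k t → FockFibre k t) :=
  (FockFibre.incl k t).isometry.isEmbedding.continuous_iff.mpr
    (continuous_expVec.comp continuous_subtype_val)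

/-- The exponential vectors are total in each fibre. -/
theorem fockExp_total (t : ℝ) :
    (Submodule.span ℂ (Set.range (fockExp : LTwoIco k t → FockFibre k t))).topologicalClosure
      = ⊤ := by
  rw [← Submodule.dense_iff_topologicalClosure_eq_top]
  intro x
  rw [(FockFibre.incl k t).isometry.isEmbedding.isInducing.closure_eq_preimage_closure_image,
    Set.mem_preimage]
  have : (FockFibre.incl k t '' (Submodule.span ℂ
      (Set.range (fockExp : LTwoIco k t → FockFibre k t)) : Set (FockFibre k t))) =
      (Submodule.span ℂ (expVec '' (LTwoIco k t : Set (LTwo k))) : Set (FullFock (LTwo k))) := by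
    change ((FockFibre.incl k t).toLinearMap '' _) = _
    rw [← Submodule.map_coe, Submodule.map_span, ← Set.range_comp]
    congr 2
    ext y
    simp [incl_fockExp]
  rw [this]
  exact x.2

/-- The shift by `s`: `(S_s g)(x) = g(x - s)`. -/
def shift (s : ℝ) : LTwo k →ₗᵢ[ℂ] LTwo k :=
  Lp.compMeasurePreservingₗᵢ ℂ (fun x => x - s) (measurePreserving_sub_right volume s)

theorem shift_coe (s : ℝ) (g : LTwo k) : shift s g =ᵐ[volume] fun x => g (x - s) :=
  Lp.coeFn_compMeasurePreserving g (measurePreserving_sub_right volume s)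

theorem ae_sub {p : ℝ → Prop} (h : ∀ᵐ x, p x) (s : ℝ) : ∀ᵐ x, p (x - s) :=
  (measurePreserving_sub_right volume s).quasiMeasurePreserving.ae h

theorem shift_shift (r s : ℝ) (g : LTwo k) : shift r (shift s g) = shift (r + s) g := by
  apply Lp.ext
  filter_upwards [shift_coe r (shift s g), ae_sub (shift_coe s g) r, shift_coe (r + s) g]
    with x h1 h2 h3
  rw [h1, h2, h3, sub_sub]

theorem shift_zero (g : LTwo k) : shift 0 g = g := by
  apply Lp.ext
  filter_upwards [shift_coe 0 g] with x h1
  rw [h1, sub_zero]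

/-- The restriction `g_[0,t[` of `g`. -/
def cut (t : ℝ) (g : LTwo k) : LTwo k :=
  ((Lp.memLp g).indicator (measurableSet_Ico (a := 0) (b := t))).toLp _

theorem cut_coe (t : ℝ) (g : LTwo k) : cut t g =ᵐ[volume] (Set.Ico 0 t).indicator g :=
  MemLp.coeFn_toLp _

theorem cut_mem (t : ℝ) (g : LTwo k) : cut t g ∈ LTwoIco k t := by
  rw [mem_LTwoIco]
  filter_upwards [cut_coe t g] with x h1 hx
  rw [h1, Set.indicator_of_notMem hx]

theorem cut_of_mem {t : ℝ} {g : LTwo k} (h : g ∈ LTwoIco k t) : cut t g = g := by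
  apply Lp.ext
  filter_upwards [cut_coe t g, mem_LTwoIco.mp h] with x h1 h2
  rw [h1]
  by_cases hx : x ∈ Set.Ico 0 t
  · rw [Set.indicator_of_mem hx]
  · rw [Set.indicator_of_notMem hx, h2 hx]

theorem join_mem {s t : ℝ} (hs : 0 ≤ s) (ht : 0 ≤ t) (f : LTwoIco k s) (g : LTwoIco k t) :
    (f : LTwo k) + shift s (g : LTwo k) ∈ LTwoIco k (s + t) := by
  rw [mem_LTwoIco]
  filter_upwards [mem_LTwoIco.mp f.2, ae_sub (mem_LTwoIco.mp g.2) s,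
    Lp.coeFn_add (f : LTwo k) (shift s (g : LTwo k)), shift_coe s (g : LTwo k)] with x h1 h2 h3 h4 hx
  rw [h3, Pi.add_apply, h4, h1, h2, add_zero]
  · simp only [Set.mem_Ico, not_and, not_lt] at hx ⊢
    intro h
    linarith [hx (by linarith)]
  · simp only [Set.mem_Ico, not_and, not_lt] at hx ⊢
    intro h
    linarith [hx (by linarith)]

/-- The concatenation `f + S_s g ∈ L²([0, s + t[; k)` of `f ∈ L²([0, s[; k)` and
`g ∈ L²([0, t[; k)`. -/
def join (s t : PosTime) (f : LTwoIco k s) (g : LTwoIco k t) : LTwoIco k (s + t : PosTime) :=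
  ⟨(f : LTwo k) + shift s (g : LTwo k), join_mem s.2.le t.2.le f g⟩

/-- The right-hand part `(S_s)^* h` of `h`, restricted to `[0, t[`. -/
theorem tail_mem {s t : ℝ} (h : LTwoIco k (s + t)) :
    shift (-s) ((h : LTwo k) - cut s (h : LTwo k)) ∈ LTwoIco k t := by
  rw [mem_LTwoIco]
  filter_upwards [ae_sub (mem_LTwoIco.mp h.2) (-s), ae_sub (cut_coe s (h : LTwo k)) (-s),
    ae_sub (Lp.coeFn_sub (h : LTwo k) (cut s (h : LTwo k))) (-s),
    shift_coe (-s) ((h : LTwo k) - cut s (h : LTwo k))] with x h1 h2 h3 h4 hx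
  rw [h4, h3, Pi.sub_apply, h2]
  by_cases hm : x - -s ∈ Set.Ico 0 s
  · rw [Set.indicator_of_mem hm, sub_self]
  · rw [Set.indicator_of_notMem hm, sub_zero, h1]
    simp only [Set.mem_Ico, not_and, not_lt] at hx hm ⊢
    intro h
    have := hm h
    linarith [hx (by linarith)]

theorem join_surjective (s t : PosTime) (h : LTwoIco k (s + t : PosTime)) :
    ∃ f g, join s t f g = h := by
  refine ⟨⟨cut s (h : LTwo k), cut_mem _ _⟩, ⟨_, tail_mem (s := s) (t := t) h⟩, Subtype.ext ?_⟩
  change cut s (h : LTwo k) + shift s (shift (-s) ((h : LTwo k) - cut s (h : LTwo k))) = h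
  rw [shift_shift, add_neg_cancel, shift_zero, add_sub_cancel]

theorem inner_shift_eq_zero {s t : ℝ} (f : LTwoIco k s) (g : LTwoIco k t) :
    ⟪(f : LTwo k), shift s (g : LTwo k)⟫_ℂ = 0 := by
  rw [L2.inner_def]
  refine integral_eq_zero_of_ae ?_
  filter_upwards [mem_LTwoIco.mp f.2, ae_sub (mem_LTwoIco.mp g.2) s, shift_coe s (g : LTwo k)]
    with x h1 h2 h3
  by_cases hx : x ∈ Set.Ico 0 s
  · rw [h3, h2]
    · simp
    · simp only [Set.mem_Ico, not_and, not_lt] at hx ⊢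
      intro h
      linarith [hx.2]
  · rw [h1 hx]
    simp

theorem inner_join (s t : PosTime) (f f' : LTwoIco k s) (g g' : LTwoIco k t) :
    ⟪(join s t f g : LTwo k), (join s t f' g' : LTwo k)⟫_ℂ =
      ⟪(f : LTwo k), (f' : LTwo k)⟫_ℂ + ⟪(g : LTwo k), (g' : LTwo k)⟫_ℂ := by
  have h1 := inner_shift_eq_zero f g'
  have h2 := inner_shift_eq_zero f' g
  rw [← inner_conj_symm, map_eq_zero] at h2
  simp only [join]
  rw [inner_add_left, inner_add_right, inner_add_right, h1, h2, LinearIsometry.inner_map_map]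
  ring

/-- The unitary `ε(f) ⊗ ε(g) ↦ ε(f + S_s g)`, the adjoint of the structure map. -/
def fockW (s t : PosTime) :
    HilbertTensor (FockFibre k s) (FockFibre k t) ≃ₗᵢ[ℂ] FockFibre k (s + t : PosTime) :=
  gramUnitary
    (fun p : LTwoIco k s × LTwoIco k t => HilbertTensor.tmul (fockExp p.1) (fockExp p.2))
    (fun p : LTwoIco k s × LTwoIco k t => fockExp (join s t p.1 p.2))
    (HilbertTensor.tmul_total (fockExp_total (s : ℝ)) (fockExp_total (t : ℝ)))
    (by
      rw [show (Set.range fun p : LTwoIco k s × LTwoIco k t => fockExp (join s t p.1 p.2)) =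
        Set.range (fockExp : LTwoIco k (s + t : PosTime) → FockFibre k (s + t : PosTime)) from ?_]
      · exact fockExp_total _
      · ext y
        constructor
        · rintro ⟨p, rfl⟩
          exact ⟨_, rfl⟩
        · rintro ⟨h, rfl⟩
          obtain ⟨f, g, rfl⟩ := join_surjective s t h
          exact ⟨(f, g), rfl⟩)
    (fun p q => by
      rw [inner_fockExp, inner_join, HilbertTensor.inner_tmul, inner_fockExp, inner_fockExp,
        Complex.exp_add])

theorem fockW_exp (s t : PosTime) (f : LTwoIco k s) (g : LTwoIco k t) :
    fockW s t (.tmul (fockExp f) (fockExp g)) = fockExp (join s t f g) :=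
  gramUnitary_apply (fun _ : LTwoIco k s × LTwoIco k t => HilbertTensor.tmul _ _) _ _ _ _ (f, g)

/-- The prescription determining the structure maps:
`ε(h) ↦ ε(h_[0,s[) ⊗ ε((S_s)^* h)`. -/
theorem fockW_symm_exp (s t : PosTime) (h : LTwoIco k (s + t : PosTime)) :
    (fockW s t).symm (fockExp h) = .tmul (fockExp ⟨cut s (h : LTwo k), cut_mem _ _⟩)
      (fockExp ⟨shift (-s) ((h : LTwo k) - cut s (h : LTwo k)), tail_mem (s := s) (t := t) h⟩) := by
  rw [LinearIsometryEquiv.symm_apply_eq, fockW_exp]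
  congr 1
  refine Subtype.ext ?_
  change _ = cut s (h : LTwo k) + shift s (shift (-s) ((h : LTwo k) - cut s (h : LTwo k)))
  rw [shift_shift, add_neg_cancel, shift_zero, add_sub_cancel]

theorem fock_assoc (r s t : PosTime) (x : FockFibre k r) (y : FockFibre k s) (z : FockFibre k t) :
    FockFibre.incl k _ (fockW (r + s) t (.tmul (fockW r s (.tmul x y)) z)) =
      FockFibre.incl k _ (fockW r (s + t) (.tmul x (fockW s t (.tmul y z)))) := by
  let W (s t : PosTime) : HilbertTensor (FockFibre k s) (FockFibre k t) →L[ℂ]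
    FockFibre k (s + t : PosTime) := (fockW s t).toContinuousLinearEquiv.toContinuousLinearMap
  let ι (t : ℝ) : FockFibre k t →L[ℂ] FullFock (LTwo k) := (FockFibre.incl k t).toContinuousLinearMap
  have h0 : ∀ (f : LTwoIco k r) (g : LTwoIco k s) (h : LTwoIco k t),
      FockFibre.incl k _ (fockW (r + s) t (.tmul (fockW r s (.tmul (fockExp f) (fockExp g)))
      (fockExp h))) = FockFibre.incl k _
      (fockW r (s + t) (.tmul (fockExp f) (fockW s t (.tmul (fockExp g) (fockExp h))))) := by
    intro f g h
    rw [fockW_exp, fockW_exp, fockW_exp, fockW_exp, incl_fockExp, incl_fockExp]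
    simp only [join, map_add, shift_shift, Positive.coe_add, add_assoc]
  have h1 : ∀ (f : LTwoIco k r) (g : LTwoIco k s),
      FockFibre.incl k _ (fockW (r + s) t (.tmul (fockW r s (.tmul (fockExp f) (fockExp g))) z)) =
      FockFibre.incl k _ (fockW r (s + t) (.tmul (fockExp f) (fockW s t (.tmul (fockExp g) z)))) :=
    fun f g => eq_of_total (fockExp_total (t : ℝ))
      (ι _ ∘L W (r + s) t ∘L HilbertTensor.tmulR (fockW r s (.tmul (fockExp f) (fockExp g))))
      (ι _ ∘L W r (s + t) ∘L HilbertTensor.tmulR (fockExp f) ∘L W s t ∘L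
        HilbertTensor.tmulR (fockExp g)) (h0 f g) z
  have h2 : ∀ f : LTwoIco k r,
      FockFibre.incl k _ (fockW (r + s) t (.tmul (fockW r s (.tmul (fockExp f) y)) z)) =
      FockFibre.incl k _ (fockW r (s + t) (.tmul (fockExp f) (fockW s t (.tmul y z)))) := fun f =>
    eq_of_total (fockExp_total (s : ℝ))
      (ι _ ∘L W (r + s) t ∘L HilbertTensor.tmulL z ∘L W r s ∘L HilbertTensor.tmulR (fockExp f))
      (ι _ ∘L W r (s + t) ∘L HilbertTensor.tmulR (fockExp f) ∘L W s t ∘L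
        HilbertTensor.tmulL z) (h1 f) y
  exact eq_of_total (fockExp_total (r : ℝ))
    (ι _ ∘L W (r + s) t ∘L HilbertTensor.tmulL z ∘L W r s ∘L HilbertTensor.tmulL y)
    (ι _ ∘L W r (s + t) ∘L HilbertTensor.tmulL (fockW s t (.tmul y z))) h2 x

theorem sigma_fock_ext {T T' : PosTime} (h : T = T') (x : FockFibre k T) (y : FockFibre k T')
    (hxy : FockFibre.incl k T x = FockFibre.incl k T' y) :
    (⟨T, x⟩ : Σ q : PosTime, FockFibre k q) = ⟨T', y⟩ := by
  subst h
  rw [(FockFibre.incl k T).injective hxy]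

variable (k) in
/-- The Fock product system over `k`. -/
def fockProductSystem : ProductSystem.{u} where
  E t := FockFibre k t
  B s t := (fockW s t).symm
  consistent r s t x y z := sigma_fock_ext (add_assoc r s t) _ _ (fock_assoc r s t x y z)

theorem inner_cut (s t : ℝ) (f : LTwo k) :
    ⟪cut s f, cut t f⟫_ℂ = ∫ x in (0 : ℝ)..(max 0 (min s t)), ⟪f x, f x⟫_ℂ := by
  rw [L2.inner_def, intervalIntegral.integral_of_le (le_max_left _ _), ← integral_Ico_eq_integral_Ioc,
    ← integral_indicator measurableSet_Ico]
  refine integral_congr_ae ?_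
  filter_upwards [cut_coe s f, cut_coe t f] with x h1 h2
  rw [h1, h2]
  simp only [Set.indicator_apply, Set.mem_Ico, lt_max_iff, lt_min_iff]
  by_cases h0 : 0 ≤ x
  · by_cases hs : x < s <;> by_cases ht : x < t <;> simp [h0, hs, ht, not_lt.mpr h0]
  · simp [h0]

theorem continuous_cut (f : LTwo k) : Continuous fun t : ℝ => cut t f := by
  have hint : ∀ a b : ℝ, IntervalIntegrable (fun x => ⟪f x, f x⟫_ℂ) volume a b := fun a b =>
    (L2.integrable_inner (𝕜 := ℂ) f f).intervalIntegrable
  have hψ : Continuous fun t : ℝ => ∫ x in (0 : ℝ)..t, ⟪f x, f x⟫_ℂ :=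
    intervalIntegral.continuous_primitive hint 0
  rw [continuous_iff_continuousAt]
  intro s
  rw [ContinuousAt, tendsto_iff_norm_sub_tendsto_zero]
  have key : ∀ t : ℝ, ‖cut t f - cut s f‖ = Real.sqrt (RCLike.re
      ((∫ x in (0 : ℝ)..(max 0 (min t t)), ⟪f x, f x⟫_ℂ)
        - (∫ x in (0 : ℝ)..(max 0 (min t s)), ⟪f x, f x⟫_ℂ)
        - (∫ x in (0 : ℝ)..(max 0 (min s t)), ⟪f x, f x⟫_ℂ)
        + (∫ x in (0 : ℝ)..(max 0 (min s s)), ⟪f x, f x⟫_ℂ))) := by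
    intro t
    rw [@norm_eq_sqrt_re_inner ℂ, inner_sub_left, inner_sub_right, inner_sub_right]
    simp only [inner_cut]
    congr 2
    ring
  have hc : Continuous fun t : ℝ => ‖cut t f - cut s f‖ := by
    simp_rw [key]
    refine Real.continuous_sqrt.comp (RCLike.continuous_re.comp ?_)
    refine ((Continuous.sub ?_ ?_).sub ?_).add continuous_const
    · exact hψ.comp (by fun_prop : Continuous fun t : ℝ => max 0 (min t t))
    · exact hψ.comp (by fun_prop : Continuous fun t : ℝ => max 0 (min t s))
    · exact hψ.comp (by fun_prop : Continuous fun t : ℝ => max 0 (min s t))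
  simpa using hc.tendsto s

theorem norm_cut_le (t : ℝ) (f : LTwo k) : ‖cut t f‖ ≤ ‖f‖ := by
  refine Lp.norm_le_norm_of_ae_le ?_
  filter_upwards [cut_coe t f] with x h1
  rw [h1]
  exact norm_indicator_le_norm_self _ _

theorem cut_sub (t : ℝ) (f g : LTwo k) : cut t (f - g) = cut t f - cut t g := by
  apply Lp.ext
  filter_upwards [cut_coe t (f - g), cut_coe t f, cut_coe t g, Lp.coeFn_sub f g,
    Lp.coeFn_sub (cut t f) (cut t g)] with x h1 h2 h3 h4 h5
  rw [h1, h5, Pi.sub_apply, h2, h3]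
  by_cases hx : x ∈ Set.Ico 0 t
  · rw [Set.indicator_of_mem hx, Set.indicator_of_mem hx, Set.indicator_of_mem hx, h4, Pi.sub_apply]
  · rw [Set.indicator_of_notMem hx, Set.indicator_of_notMem hx, Set.indicator_of_notMem hx, sub_zero]

/-- The restriction `g_[0,t[`, as an element of `L²([0, t[; k)`. -/
def cutIco (t : ℝ) (g : LTwo k) : LTwoIco k t := ⟨cut t g, cut_mem t g⟩

theorem continuous_cutIco (t : ℝ) : Continuous (cutIco t : LTwo k → LTwoIco k t) := by
  refine Continuous.subtype_mk (LipschitzWith.continuous (K := 1) ?_) _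
  refine LipschitzWith.of_dist_le_mul fun f g => ?_
  rw [dist_eq_norm, dist_eq_norm, ← cut_sub, NNReal.coe_one, one_mul]
  exact norm_cut_le t _

theorem continuous_shift_cut (g : LTwo k) :
    Continuous fun p : ℝ × ℝ => shift p.1 (cut p.2 g) := by
  have h1 : Continuous fun p : ℝ × ℝ => cut p.2 g := (continuous_cut g).comp continuous_snd
  let F : C((ℝ × ℝ) × ℝ, ℝ) := ⟨fun q => q.2 - q.1.1, by fun_prop⟩
  exact h1.compMeasurePreservingLp (g := fun p => F.curry p) F.curry.continuous
    (fun p => measurePreserving_sub_right volume p.1) (by norm_num)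

section separable
variable [TopologicalSpace.SeparableSpace k]

variable (k) in
/-- A dense sequence in `L²(ℝ; k)`. -/
def denseLTwo (n : ℕ) : LTwo k :=
  haveI : SecondCountableTopology k := UniformSpace.secondCountable_of_separable k
  haveI : Fact ((2 : ℝ≥0∞) ≠ ∞) := ⟨by norm_num⟩
  TopologicalSpace.denseSeq (LTwo k) n

theorem denseRange_denseLTwo : DenseRange (denseLTwo k) :=
  haveI : SecondCountableTopology k := UniformSpace.secondCountable_of_separable k
  haveI : Fact ((2 : ℝ≥0∞) ≠ ∞) := ⟨by norm_num⟩
  TopologicalSpace.denseRange_denseSeq (LTwo k)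

variable (k) in
/-- The sections `t ↦ ε((d_n)_[0,t[)`, for a dense sequence `d` of `L²`, which determine the
measurable structure of the Fock Arveson system. -/
def fockSection (n : ℕ) (t : PosTime) : FockFibre k t := fockExp (cutIco t (denseLTwo k n))

theorem fockSection_total (t : PosTime) :
    (Submodule.span ℂ (Set.range fun n => fockSection k n t)).topologicalClosure = ⊤ := by
  rw [eq_top_iff, ← fockExp_total (k := k) (t : ℝ)]
  refine Submodule.topologicalClosure_minimal _ ?_ (Submodule.isClosed_topologicalClosure _)
  rw [Submodule.span_le]
  rintro _ ⟨g, rfl⟩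
  have hg : cutIco t (g : LTwo k) = g := Subtype.ext (cut_of_mem g.2)
  have hc : Continuous fun f : LTwo k => fockExp (cutIco t f) :=
    continuous_fockExp.comp (continuous_cutIco t)
  have := hc.range_subset_closure_image_dense denseRange_denseLTwo ⟨(g : LTwo k), rfl⟩
  rw [SetLike.mem_coe, ← SetLike.mem_coe, Submodule.topologicalClosure_coe]
  simp only [hg] at this
  refine closure_mono ?_ this
  rw [← Set.range_comp]
  exact Submodule.subset_span

variable (k) in
/-- The Fock Arveson system over a separable Hilbert space `k`. -/
def fockArvesonSystem : ArvesonSystem.{u} where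
  toProductSystem := fockProductSystem k
  e n t := fockSection k n t
  total t := fockSection_total t
  measurable_inner m n := by
    have : Continuous fun t : PosTime => Complex.exp
        ⟪cut (t : ℝ) (denseLTwo k m), cut (t : ℝ) (denseLTwo k n)⟫_ℂ :=
      Complex.continuous_exp.comp
        (((continuous_cut _).comp continuous_subtype_val).inner
          ((continuous_cut _).comp continuous_subtype_val))
    have he : ∀ t : PosTime, ⟪fockSection k m t, fockSection k n t⟫_ℂ = Complex.exp
        ⟪cut (t : ℝ) (denseLTwo k m), cut (t : ℝ) (denseLTwo k n)⟫_ℂ := fun t =>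
      inner_fockExp _ _
    have := this.measurable
    simp_rw [← he] at this
    exact this
  measurable_B l m n := by
    have hc : Continuous fun p : PosTime × PosTime => Complex.exp
        ⟪cut (p.1 : ℝ) (denseLTwo k m) + shift (p.1 : ℝ) (cut (p.2 : ℝ) (denseLTwo k n)),
          cut ((p.1 : ℝ) + (p.2 : ℝ)) (denseLTwo k l)⟫_ℂ := by
      refine Complex.continuous_exp.comp (Continuous.inner (Continuous.add ?_ ?_) ?_)
      · exact (continuous_cut _).comp (by fun_prop)
      · exact (continuous_shift_cut (denseLTwo k n)).comp
          (by fun_prop : Continuous fun p : PosTime × PosTime => ((p.1 : ℝ), (p.2 : ℝ)))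
      · exact (continuous_cut (denseLTwo k l)).comp
          (by fun_prop : Continuous fun p : PosTime × PosTime => (p.1 : ℝ) + (p.2 : ℝ))
    have he : ∀ p : PosTime × PosTime, ⟪HilbertTensor.tmul (fockSection k m p.1)
        (fockSection k n p.2), (fockW p.1 p.2).symm (fockSection k l (p.1 + p.2))⟫_ℂ = Complex.exp
        ⟪cut (p.1 : ℝ) (denseLTwo k m) + shift (p.1 : ℝ) (cut (p.2 : ℝ) (denseLTwo k n)),
          cut ((p.1 : ℝ) + (p.2 : ℝ)) (denseLTwo k l)⟫_ℂ := by
      intro p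
      rw [← (fockW p.1 p.2).inner_map_map, LinearIsometryEquiv.apply_symm_apply, fockSection,
        fockSection, fockW_exp, fockSection, inner_fockExp]
      rfl
    have := hc.measurable
    simp_rw [← he] at this
    exact this

variable (k) in
/-- The vacuum `Ω = ε(0)` in each fibre. -/
def vacuum (t : PosTime) : FockFibre k t := fockExp 0

theorem norm_vacuum (t : PosTime) : ‖vacuum k t‖ = 1 := by
  have := inner_fockExp (0 : LTwoIco k t) 0
  rw [@norm_eq_sqrt_re_inner ℂ, vacuum, this]
  simp

variable (k) in
/-- The Fock Arveson system over `k`, pointed by its vacuum unit. -/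
def fockPointed : PointedArvesonSystem.{u} where
  toArvesonSystem := fockArvesonSystem k
  unit := vacuum k
  isUnit :=
    { measurable := fun n => by
        have : ∀ t : PosTime, ⟪fockSection k n t, vacuum k t⟫_ℂ = 1 := fun t => by
          rw [fockSection, vacuum, inner_fockExp]
          simp
        change Measurable fun t : PosTime => ⟪fockSection k n t, vacuum k t⟫_ℂ
        simp_rw [this]
        exact measurable_const
      ne_zero := fun h => by
        have := norm_vacuum (k := k) ⟨1, one_pos⟩
        rw [show vacuum k ⟨1, one_pos⟩ = 0 from congrFun h ⟨1, one_pos⟩, norm_zero] at this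
        exact zero_ne_one this
      mul := fun s t => by
        change vacuum k (s + t) = fockW s t (.tmul (vacuum k s) (vacuum k t))
        rw [vacuum, vacuum, vacuum, fockW_exp]
        congr 1
        refine Subtype.ext ?_
        simp [join] }
  norm_unit := norm_vacuum

end separable

/-- The function `c_[0,t[`, equal to `c` on `[0, t[` and `0` elsewhere. -/
def indicatorIco (c : k) (t : ℝ) : LTwoIco k t :=
  ⟨indicatorConstLp 2 (measurableSet_Ico (a := (0 : ℝ)) (b := t)) (by simp) c, by
    rw [mem_LTwoIco]
    exact indicatorConstLp_coeFn_notMem⟩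

/-- The section `χ^c = (c_[0,t[)_t` of one-particle vectors. -/
def chi (c : k) (t : PosTime) : FockFibre k t := fockOne (indicatorIco c t)

end FockSystem

end

noncomputable section

section Roots
variable {k : Type u} [NormedAddCommGroup k] [InnerProductSpace ℂ k]

/-! ### One-particle vectors -/

/-! A root has no component of particle number at least two, because such a component would not
survive repeated halving of the time interval. For a root `a`, both `⟪fockExp f, a t⟫` and `⟪fockOne
f, a t⟫` are additive when `f` is split by concatenation, so their difference is additive too. As `a
t ⟂ Ω`, this difference equals `⟪fockExp f - Ω - fockOne f, a t⟫`, which is bounded by a constant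
times `‖f‖ ^ 2 * ‖a t‖`. Halving `t` splits `‖f‖ ^ 2` additively and divides `‖a t‖` by `√2`, so
each halving improves the bound by a factor `√2` and the difference is zero
(`norm_inner_fockExp_sub_le`, `inner_fockExp_rootAt`). Since exponential vectors are total, the
Riesz theorem gives `a t = fockOne (g t)` (`exists_rootAt_eq_fockOne`).

The root equation now says that `g (s + t)` is the concatenation of `g s` and `g t`. Cutting `[0,
2[` as `s + (2 - s)` and as `(2 - s) + s` shows that `g 2` agrees almost everywhere with its
translates, so by Fubini it is constant on `[0, 1[` (`exists_eq_indicatorIco`). A root is determined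
by its value at time `1`, hence `a = χ^c`. Conversely, `fockOne_join` applied to concatenated
indicators shows that each `χ^c` is a root; the map is isometric since `[0, 1[` has measure `1`. -/

theorem powVec_add_one (g h : LTwo k) : powVec (g + h) 1 = powVec g 1 + powVec h 1 := by
  rw [powVec, powVec, powVec, ← Completion.coe_add]
  exact congrArg _ (TensorProduct.add_tmul g h _)

theorem powVec_smul_one (c : ℂ) (h : LTwo k) : powVec (c • h) 1 = c • powVec h 1 := by
  rw [powVec, powVec, ← Completion.coe_smul]
  exact congrArg _ (TensorProduct.smul_tmul' c h _).symm

theorem oneParticle_add (g h : LTwo k) : oneParticle (g + h) = oneParticle g + oneParticle h := by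
  rw [oneParticle, powVec_add_one, lp.single_add]
  rfl

theorem oneParticle_smul (c : ℂ) (h : LTwo k) : oneParticle (c • h) = c • oneParticle h := by
  rw [oneParticle, powVec_smul_one, lp.single_smul]
  rfl

/-- The inclusion of the one-particle space in a fibre as a linear isometry. -/
def fockOneₗᵢ (t : ℝ) : LTwoIco k t →ₗᵢ[ℂ] FockFibre k t where
  toFun := fockOne
  map_add' f g := (FockFibre.incl k t).injective (oneParticle_add (f : LTwo k) g)
  map_smul' c f := (FockFibre.incl k t).injective (oneParticle_smul c (f : LTwo k))
  norm_map' f := norm_oneParticle (f : LTwo k)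

theorem inner_fockExp_fockOne {t : ℝ} (f g : LTwoIco k t) :
    ⟪fockExp f, fockOne g⟫_ℂ = ⟪(f : LTwo k), (g : LTwo k)⟫_ℂ :=
  inner_expVec_oneParticle _ _

/-! ### Testing against exponential vectors. -/

theorem FockFibre.ext_inner_fockExp {t : ℝ} {x y : FockFibre k t}
    (h : ∀ f : LTwoIco k t, ⟪fockExp f, x⟫_ℂ = ⟪fockExp f, y⟫_ℂ) : x = y := by
  refine ext_inner_right ℂ fun z => ?_
  refine eq_of_total (fockExp_total t) (innerSL ℂ x) (innerSL ℂ y) (fun f => ?_) z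
  rw [innerSL_apply_apply, innerSL_apply_apply, ← inner_conj_symm, h f, inner_conj_symm]

/-- By `join_surjective` every exponential vector at time `s + t` has the form used here, so this
formula determines products in the fibre completely. -/
theorem inner_fockExp_join_fockW (s t : PosTime) (f : LTwoIco k s) (g : LTwoIco k t)
    (x : FockFibre k s) (y : FockFibre k t) :
    ⟪fockExp (join s t f g), fockW s t (.tmul x y)⟫_ℂ = ⟪fockExp f, x⟫_ℂ * ⟪fockExp g, y⟫_ℂ := by
  rw [← fockW_exp, LinearIsometryEquiv.inner_map_map, HilbertTensor.inner_tmul]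

theorem inner_fockExp_vacuum {t : PosTime} (f : LTwoIco k t) : ⟪fockExp f, vacuum k t⟫_ℂ = 1 := by
  rw [vacuum, inner_fockExp]
  simp

/-- Tested against the exponential vector of a concatenation of `h₁` and `h₂`, both sides give `⟪h₁,
f⟫ + ⟪h₂, g⟫`. This translates the addit equation for one-particle vectors into concatenation in
`L²`, and is used in both directions. -/
theorem fockOne_join (s t : PosTime) (f : LTwoIco k s) (g : LTwoIco k t) :
    fockOne (join s t f g) =
      fockW s t (.tmul (fockOne f) (vacuum k t)) + fockW s t (.tmul (vacuum k s) (fockOne g)) := by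
  refine FockFibre.ext_inner_fockExp fun h => ?_
  obtain ⟨h₁, h₂, rfl⟩ := join_surjective s t h
  rw [inner_add_right, inner_fockExp_join_fockW, inner_fockExp_join_fockW, inner_fockExp_fockOne,
    inner_join, inner_fockExp_fockOne, inner_fockExp_fockOne, inner_fockExp_vacuum,
    inner_fockExp_vacuum]
  ring

theorem inner_vacuum_fockOne {t : PosTime} (f : LTwoIco k t) : ⟪vacuum k t, fockOne f⟫_ℂ = 0 := by
  rw [vacuum, inner_fockExp_fockOne]
  simp

/-- The part of an exponential vector of particle number at least two. -/
theorem norm_sq_fockExp_sub {t : PosTime} (f : LTwoIco k t) :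
    ‖fockExp f - vacuum k t - fockOne f‖ ^ 2 = Real.exp (‖f‖ ^ 2) - 1 - ‖f‖ ^ 2 := by
  have h1 : ⟪fockExp f, fockExp f⟫_ℂ = Complex.exp (‖f‖ ^ 2 : ℝ) := by
    rw [inner_fockExp, inner_self_eq_norm_sq_to_K]
    push_cast
    rfl
  have h2 : ⟪fockExp f, fockOne f⟫_ℂ = (‖f‖ ^ 2 : ℝ) := by
    rw [inner_fockExp_fockOne, inner_self_eq_norm_sq_to_K]
    push_cast
    rfl
  have h3 : ⟪fockOne f, fockExp f⟫_ℂ = (‖f‖ ^ 2 : ℝ) := by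
    rw [← inner_conj_symm, h2, Complex.conj_ofReal]
  have h4 : ⟪fockOne f, fockOne f⟫_ℂ = (‖f‖ ^ 2 : ℝ) := by
    rw [inner_self_eq_norm_sq_to_K, show ‖fockOne f‖ = ‖f‖ from norm_oneParticle _]
    push_cast
    rfl
  have h5 : ⟪vacuum k t, fockExp f⟫_ℂ = 1 := by
    rw [← inner_conj_symm, inner_fockExp_vacuum, map_one]
  have h6 : ⟪fockOne f, vacuum k t⟫_ℂ = 0 := by
    rw [← inner_conj_symm, inner_vacuum_fockOne, map_zero]
  have key : ((‖fockExp f - vacuum k t - fockOne f‖ ^ 2 : ℝ) : ℂ) =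
      ((Real.exp (‖f‖ ^ 2) - 1 - ‖f‖ ^ 2 : ℝ) : ℂ) := by
    have : ⟪fockExp f - vacuum k t - fockOne f, fockExp f - vacuum k t - fockOne f⟫_ℂ =
        Complex.exp (‖f‖ ^ 2 : ℝ) - 1 - (‖f‖ ^ 2 : ℝ) := by
      simp only [inner_sub_left, inner_sub_right, h1, h2, h3, h4, h5, h6, inner_fockExp_vacuum,
        inner_vacuum_fockOne]
      rw [show ⟪vacuum k t, vacuum k t⟫_ℂ = 1 from inner_fockExp_vacuum _]
      ring
    rw [inner_self_eq_norm_sq_to_K] at this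
    push_cast at this ⊢
    exact this
  exact_mod_cast key

/-- Multiplying `1 - x ≤ exp (-x)` by `exp x` gives `exp x - 1 ≤ x * exp x`; using this twice, `exp
x - 1 - x ≤ x * (exp x - 1) ≤ x ^ 2 * exp x`. -/
theorem Real.exp_sub_one_sub_id_le {x : ℝ} (hx : 0 ≤ x) :
    Real.exp x - 1 - x ≤ x ^ 2 * Real.exp x := by
  have h1 : Real.exp x - 1 ≤ x * Real.exp x := by
    have h := mul_le_mul_of_nonneg_right (Real.one_sub_le_exp_neg x) (Real.exp_pos x).le
    rw [← Real.exp_add, neg_add_cancel, Real.exp_zero] at h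
    linarith
  nlinarith [mul_le_mul_of_nonneg_left h1 hx]

/-- The bound is quadratic in `‖f‖`, so it adds up under concatenation. The separate parameter `M`
keeps the constant unchanged when `f` is replaced by its pieces. -/
theorem norm_fockExp_sub_le {t : PosTime} (f : LTwoIco k t) {M : ℝ} (hM : ‖f‖ ^ 2 ≤ M) :
    ‖fockExp f - vacuum k t - fockOne f‖ ≤ Real.exp M * ‖f‖ ^ 2 := by
  refine le_of_sq_le_sq ?_ (by positivity)
  rw [norm_sq_fockExp_sub]
  have h0 : 0 ≤ ‖f‖ ^ 2 := by positivity
  have h1 : Real.exp (‖f‖ ^ 2) ≤ Real.exp M := Real.exp_le_exp.mpr hM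
  have h2 : 1 ≤ Real.exp M := Real.one_le_exp (h0.trans hM)
  calc _ ≤ (‖f‖ ^ 2) ^ 2 * Real.exp (‖f‖ ^ 2) := Real.exp_sub_one_sub_id_le h0
    -- The second factor `exp M ≥ 1` is inserted only to make the bound a perfect square.
    _ ≤ (‖f‖ ^ 2) ^ 2 * (Real.exp M * Real.exp M) := by
      gcongr
      nlinarith
    _ = _ := by ring

theorem norm_sq_join (s t : PosTime) (f : LTwoIco k s) (g : LTwoIco k t) :
    ‖join s t f g‖ ^ 2 = ‖f‖ ^ 2 + ‖g‖ ^ 2 := by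
  have h := inner_join s t f f g g
  simp only [inner_self_eq_norm_sq_to_K] at h
  exact_mod_cast h

/-- It is the fixed-point set of the continuous map `cut t`. Closedness provides the completeness
needed for the Riesz theorem. -/
theorem isClosed_LTwoIco (t : ℝ) : IsClosed (LTwoIco k t : Set (LTwo k)) := by
  have : (LTwoIco k t : Set (LTwo k)) = {g | cut t g = g} :=
    Set.ext fun g => ⟨cut_of_mem, fun h => by
      rw [SetLike.mem_coe, ← show cut t g = g from h]
      exact cut_mem t g⟩
  rw [this]
  exact isClosed_eq (continuous_subtype_val.comp (continuous_cutIco t)) continuous_id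

/-! ### Roots are one-particle vectors -/

section separable
variable [TopologicalSpace.SeparableSpace k] (a : (fockPointed k).Root)

/-- The value of a root at time `t`, as an element of the Fock fibre. -/
def rootAt (t : PosTime) : FockFibre k t := a t

theorem rootAt_add (s t : PosTime) : rootAt a (s + t) =
    fockW s t (.tmul (rootAt a s) (vacuum k t)) + fockW s t (.tmul (vacuum k s) (rootAt a t)) :=
  a.isRoot.add s t

theorem inner_vacuum_rootAt (t : PosTime) : ⟪vacuum k t, rootAt a t⟫_ℂ = 0 :=
  a.isRoot.orthogonal t

theorem norm_sq_rootAt_add (s t : PosTime) :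
    ‖rootAt a (s + t)‖ ^ 2 = ‖rootAt a s‖ ^ 2 + ‖rootAt a t‖ ^ 2 :=
  PointedArvesonSystem.Root.norm_sq_add a s t

/-- The product becomes a sum because each term of the addit equation has one vacuum factor, and
exponential vectors pair with the vacuum to `1`. -/
theorem inner_fockExp_join_rootAt (s t : PosTime) (f : LTwoIco k s) (g : LTwoIco k t) :
    ⟪fockExp (join s t f g), rootAt a (s + t)⟫_ℂ =
      ⟪fockExp f, rootAt a s⟫_ℂ + ⟪fockExp g, rootAt a t⟫_ℂ := by
  rw [rootAt_add, inner_add_right, inner_fockExp_join_fockW, inner_fockExp_join_fockW,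
    inner_fockExp_vacuum, inner_fockExp_vacuum, mul_one, one_mul]

/-- Expanding both sums leaves two mixed terms, which vanish because one-particle vectors and roots
are orthogonal to the vacuum. -/
theorem inner_fockOne_join_rootAt (s t : PosTime) (f : LTwoIco k s) (g : LTwoIco k t) :
    ⟪fockOne (join s t f g), rootAt a (s + t)⟫_ℂ =
      ⟪fockOne f, rootAt a s⟫_ℂ + ⟪fockOne g, rootAt a t⟫_ℂ := by
  have hf : ⟪fockOne f, vacuum k s⟫_ℂ = 0 := by
    rw [← inner_conj_symm, inner_vacuum_fockOne, map_zero]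
  rw [rootAt_add, fockOne_join]
  simp only [inner_add_left, inner_add_right, LinearIsometryEquiv.inner_map_map,
    HilbertTensor.inner_tmul, inner_vacuum_rootAt, hf]
  rw [show ⟪vacuum k t, vacuum k t⟫_ℂ = 1 from inner_fockExp_vacuum _,
    show ⟪vacuum k s, vacuum k s⟫_ℂ = 1 from inner_fockExp_vacuum _]
  ring

/-- The half of a time. -/
theorem PosTime.exists_half (t : PosTime) : ∃ s : PosTime, t = s + s :=
  ⟨⟨t.1 / 2, half_pos t.2⟩, Subtype.ext (by rw [Positive.coe_add]; simp)⟩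

/-- Here `n` counts the halvings of the time interval. The induction runs over all `t` and `f` at
once, since its step passes to the two halves. -/
theorem norm_inner_fockExp_sub_le (M : ℝ) (n : ℕ) : ∀ (t : PosTime) (f : LTwoIco k t),
    ‖f‖ ^ 2 ≤ M → ‖⟪fockExp f, rootAt a t⟫_ℂ - ⟪fockOne f, rootAt a t⟫_ℂ‖ ≤
      Real.exp M * ‖f‖ ^ 2 * (‖rootAt a t‖ / √2 ^ n) := by
  induction n with
  | zero =>
    intro t f hf
    -- The vacuum may be subtracted freely since it is orthogonal to the root; without it the
    -- remainder would not be quadratic in `‖f‖`.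
    have : ⟪fockExp f, rootAt a t⟫_ℂ - ⟪fockOne f, rootAt a t⟫_ℂ =
        ⟪fockExp f - vacuum k t - fockOne f, rootAt a t⟫_ℂ := by
      rw [inner_sub_left, inner_sub_left, inner_vacuum_rootAt, sub_zero]
    rw [this, pow_zero, div_one]
    refine (norm_inner_le_norm _ _).trans ?_
    gcongr
    exact norm_fockExp_sub_le f hf
  | succ n ih =>
    intro t f hf
    obtain ⟨s, rfl⟩ := t.exists_half
    obtain ⟨f₁, f₂, rfl⟩ := join_surjective s s f
    have hn := norm_sq_join s s f₁ f₂
    -- Squared norms of a root add over time, so half the time carries half the squared norm. This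
    -- is the gained factor `√2`.
    have ha : ‖rootAt a s‖ = ‖rootAt a (s + s)‖ / √2 := by
      rw [eq_div_iff (by positivity)]
      refine (sq_eq_sq₀ (by positivity) (norm_nonneg _)).mp ?_
      rw [norm_sq_rootAt_add, mul_pow, Real.sq_sqrt (by norm_num)]
      ring
    have h1 := ih s f₁ (by nlinarith [sq_nonneg ‖f₂‖])
    have h2 := ih s f₂ (by nlinarith [sq_nonneg ‖f₁‖])
    rw [inner_fockExp_join_rootAt, inner_fockOne_join_rootAt, add_sub_add_comm]
    refine (norm_add_le _ _).trans ((add_le_add h1 h2).trans_eq ?_)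
    rw [hn, ha, pow_succ]
    field_simp
    ring

/-- The preceding bound holds for every `n` and tends to `0`. Thus a root sees only the one-particle
part of an exponential vector. -/
theorem inner_fockExp_rootAt (t : PosTime) (f : LTwoIco k t) :
    ⟪fockExp f, rootAt a t⟫_ℂ = ⟪fockOne f, rootAt a t⟫_ℂ := by
  rw [← sub_eq_zero, ← norm_le_zero_iff]
  have hlim : Filter.Tendsto (fun n : ℕ => Real.exp (‖f‖ ^ 2) * ‖f‖ ^ 2 *
      (‖rootAt a t‖ / √2 ^ n)) Filter.atTop (nhds (Real.exp (‖f‖ ^ 2) * ‖f‖ ^ 2 * 0)) := by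
    refine Filter.Tendsto.const_mul _ (Filter.Tendsto.const_div_atTop ?_ _)
    exact tendsto_pow_atTop_atTop_of_one_lt (Real.one_lt_sqrt_two)
  rw [mul_zero] at hlim
  exact ge_of_tendsto' hlim fun n => norm_inner_fockExp_sub_le a _ n t f le_rfl

variable [CompleteSpace k]

/-- The vector `g` represents the bounded functional `f ↦ ⟪rootAt a t, fockOne f⟫` on `L²([0, t[;
k)`. By `inner_fockExp_rootAt`, `fockOne g` and the root then have the same inner products with all
exponential vectors. -/
theorem exists_rootAt_eq_fockOne (t : PosTime) :
    ∃ g : LTwoIco k t, rootAt a t = fockOne g := by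
  have : CompleteSpace (LTwoIco k t) := (isClosed_LTwoIco (k := k) (t : ℝ)).completeSpace_coe
  let g := (InnerProductSpace.toDual ℂ (LTwoIco k t)).symm
    ((innerSL ℂ (rootAt a t)).comp (fockOneₗᵢ (k := k) t).toContinuousLinearMap)
  refine ⟨g, FockFibre.ext_inner_fockExp fun f => ?_⟩
  rw [inner_fockExp_rootAt, inner_fockExp_fockOne, ← inner_conj_symm, ← inner_conj_symm (f : LTwo k)]
  congr 1
  change _ = ⟪g, f⟫_ℂ
  rw [InnerProductSpace.toDual_symm_apply]
  rfl

end separable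

/-! ### Stationary families are constant -/

/-- A function on `[0, 2[` which for each `s` agrees almost everywhere with its translate by `s` is
almost everywhere constant on `[0, 1[`. -/
theorem exists_ae_eq_const_of_translate {X : Type*} [TopologicalSpace X]
    [TopologicalSpace.MetrizableSpace X] {G : ℝ → X} (hG : StronglyMeasurable G)
    (h : ∀ s ∈ Set.Ioo (0 : ℝ) 2, ∀ᵐ x, x ∈ Set.Ico s 2 → G x = G (x - s)) :
    ∃ c, ∀ᵐ y, y ∈ Set.Ico (0 : ℝ) 1 → G y = c := by
  -- The exceptional null set depends on `s`. Joint measurability allows Fubini to exchange "for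
  -- almost every `s`" and "for almost every `x`".
  have hms : MeasurableSet {p : ℝ × ℝ | p.1 ∈ Set.Ioo (0 : ℝ) 2 → p.2 ∈ Set.Ico p.1 2 →
      G p.2 = G (p.2 - p.1)} := by
    refine MeasurableSet.imp (measurableSet_Ioo.preimage measurable_fst) (MeasurableSet.imp ?_ ?_)
    · exact (measurableSet_le measurable_fst measurable_snd).inter
        (measurableSet_lt measurable_snd measurable_const)
    · exact (hG.comp_measurable measurable_snd).measurableSet_eq_fun
        (hG.comp_measurable (measurable_snd.sub measurable_fst))
  have h' : ∀ᵐ s : ℝ, ∀ᵐ x : ℝ, s ∈ Set.Ioo (0 : ℝ) 2 → x ∈ Set.Ico s 2 → G x = G (x - s) := by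
    refine Filter.Eventually.of_forall fun s => ?_
    by_cases hs : s ∈ Set.Ioo (0 : ℝ) 2
    · filter_upwards [h s hs] with x hx _ using hx
    · exact Filter.Eventually.of_forall fun x hs' => absurd hs' hs
  rw [Measure.ae_ae_comm hms] at h'
  -- One good point `x` in `]1, 2[` suffices: for every `y` in `[0, 1[` the translation `s = x - y`
  -- is admissible. This is why the hypothesis covers an interval of length `2`.
  obtain ⟨x, hx, hx'⟩ : ∃ x ∈ Set.Ioo (1 : ℝ) 2, ∀ᵐ s : ℝ, s ∈ Set.Ioo (0 : ℝ) 2 →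
      x ∈ Set.Ico s 2 → G x = G (x - s) := by
    by_contra hc
    have h0 : volume (Set.Ioo (1 : ℝ) 2) = 0 := by
      refine measure_mono_null (fun x hx => ?_) (ae_iff.mp h')
      exact fun hn => hc ⟨x, hx, hn⟩
    norm_num [Real.volume_Ioo] at h0
  refine ⟨G x, ?_⟩
  -- The reflection `y ↦ x - y` preserves null sets, so almost every `s` becomes almost every `y`.
  filter_upwards [(Measure.measurePreserving_sub_left volume x).quasiMeasurePreserving.ae hx'] with y hy hy1
  have := hy ⟨by linarith [hx.1, hy1.2], by linarith [hx.2, hy1.1]⟩ ⟨by linarith [hy1.1], hx.2⟩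
  rw [this, sub_sub_cancel]

/-! ### Concatenation pointwise, and additive families. -/

theorem join_apply_left (s t : PosTime) (f : LTwoIco k s) (g : LTwoIco k t) :
    ∀ᵐ x, x < (s : ℝ) → (join s t f g : LTwo k) x = (f : LTwo k) x := by
  filter_upwards [ae_sub (mem_LTwoIco.mp g.2) s, shift_coe s (g : LTwo k),
    Lp.coeFn_add (f : LTwo k) (shift s (g : LTwo k))] with x h1 h2 h3 hx
  rw [join, h3, Pi.add_apply, h2, h1 (fun h => by linarith [h.1]), add_zero]

theorem join_apply_right (s t : PosTime) (f : LTwoIco k s) (g : LTwoIco k t) :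
    ∀ᵐ x, (s : ℝ) ≤ x → (join s t f g : LTwo k) x = (g : LTwo k) (x - s) := by
  filter_upwards [mem_LTwoIco.mp f.2, shift_coe s (g : LTwo k),
    Lp.coeFn_add (f : LTwo k) (shift s (g : LTwo k))] with x h1 h2 h3 hx
  rw [join, h3, Pi.add_apply, h2, h1 (fun h => by linarith [h.2]), zero_add]

theorem indicatorIco_coe (c : k) (t : ℝ) :
    (indicatorIco c t : LTwo k) =ᵐ[volume] (Set.Ico 0 t).indicator fun _ => c :=
  indicatorConstLp_coeFn (hs := measurableSet_Ico) (hμs := by simp)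

/-- A family which is additive for concatenation is constant. -/
theorem exists_eq_indicatorIco {g : ∀ t : PosTime, LTwoIco k t}
    (hg : ∀ s t, g (s + t) = join s t (g s) (g t)) :
    ∃ c : k, g ⟨1, one_pos⟩ = indicatorIco c 1 := by
  obtain ⟨c, hc⟩ := exists_ae_eq_const_of_translate (G := (g ⟨2, two_pos⟩ : LTwo k))
    (Lp.stronglyMeasurable _) (by
      intro s hs
      let p : PosTime := ⟨s, hs.1⟩
      let q : PosTime := ⟨2 - s, by linarith [hs.2]⟩
      have hpq : (⟨2, two_pos⟩ : PosTime) = p + q := Subtype.ext (by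
        rw [Positive.coe_add]; simp [p, q])
      have hqp : (⟨2, two_pos⟩ : PosTime) = q + p := hpq.trans (add_comm p q)
      -- With `q = 2 - s`, the first splitting gives `g 2 x = g q (x - s)` for `x ≥ s`, the second
      -- gives `g 2 (x - s) = g q (x - s)` for `x < 2`; comparison yields translation invariance.
      have e1 : (g ⟨2, two_pos⟩ : LTwo k) = join p q (g p) (g q) := by rw [hpq, hg]
      have e2 : (g ⟨2, two_pos⟩ : LTwo k) = join q p (g q) (g p) := by rw [hqp, hg]
      have h1 := join_apply_right p q (g p) (g q)
      have h2 := ae_sub (join_apply_left q p (g q) (g p)) s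
      rw [← e1] at h1
      rw [← e2] at h2
      filter_upwards [h1, h2] with x hx1 hx2 hx
      rw [hx1 hx.1, hx2 (by change x - s < 2 - s; linarith [hx.2])])
  refine ⟨c, Subtype.ext (Lp.ext ?_)⟩
  -- On `[0, 1[` the function `g 2` coincides with `g 1`, so the constant found for the former
  -- serves for the latter.
  have h2 : (⟨2, two_pos⟩ : PosTime) = ⟨1, one_pos⟩ + ⟨1, one_pos⟩ := Subtype.ext (by
    rw [Positive.coe_add]; norm_num)
  have e : (g ⟨2, two_pos⟩ : LTwo k) = join _ _ (g ⟨1, one_pos⟩) (g ⟨1, one_pos⟩) := by rw [h2, hg]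
  have h1 := join_apply_left _ _ (g ⟨1, one_pos⟩) (g ⟨1, one_pos⟩)
  rw [← e] at h1
  filter_upwards [h1, hc, indicatorIco_coe c 1, mem_LTwoIco.mp (g ⟨1, one_pos⟩).2] with x h1 h3 h4 h5
  rw [h4]
  by_cases hx : x ∈ Set.Ico (0 : ℝ) 1
  · rw [Set.indicator_of_mem hx, ← h3 hx, h1 hx.2]
  · rw [Set.indicator_of_notMem hx, h5 hx]

theorem join_indicatorIco (c : k) (s t : PosTime) :
    join s t (indicatorIco c s) (indicatorIco c t) = indicatorIco c (s + t : PosTime) := by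
  refine Subtype.ext (Lp.ext ?_)
  filter_upwards [join_apply_left s t (indicatorIco c s) (indicatorIco c t),
    join_apply_right s t (indicatorIco c s) (indicatorIco c t), indicatorIco_coe c s,
    ae_sub (indicatorIco_coe c t) s, indicatorIco_coe c (s + t : PosTime)] with x h1 h2 h3 h4 h5
  have hs := s.2
  have ht := t.2
  rw [h5]
  simp only [Set.indicator_apply, Set.mem_Ico, Positive.coe_add] at h3 h4 ⊢
  rcases lt_or_ge x (s : ℝ) with hx | hx
  · rw [h1 hx, h3]
    simp only [hx, show x < (s : ℝ) + t by linarith]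
  · rw [h2 hx, h4]
    simp only [sub_nonneg, hx, hs.le.trans hx, sub_lt_iff_lt_add']

/-! ### Linearity, norm and measurability of the indicator sections. -/

theorem indicatorIco_add (c d : k) (t : ℝ) :
    indicatorIco (c + d) t = indicatorIco c t + indicatorIco d t := by
  refine Subtype.ext (Lp.ext ?_)
  filter_upwards [indicatorIco_coe c t, indicatorIco_coe d t, indicatorIco_coe (c + d) t,
    Lp.coeFn_add (indicatorIco c t : LTwo k) (indicatorIco d t : LTwo k)] with x h1 h2 h3 h4
  rw [h3, Submodule.coe_add, h4, Pi.add_apply, h1, h2]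
  exact congrFun (Set.indicator_add (Set.Ico 0 t) (fun _ => c) fun _ => d) x

theorem indicatorIco_smul (z : ℂ) (c : k) (t : ℝ) :
    indicatorIco (z • c) t = z • indicatorIco c t := by
  refine Subtype.ext (Lp.ext ?_)
  filter_upwards [indicatorIco_coe c t, indicatorIco_coe (z • c) t,
    Lp.coeFn_smul z (indicatorIco c t : LTwo k)] with x h1 h2 h3
  rw [h2, Submodule.coe_smul, h3, Pi.smul_apply, h1, Set.indicator_const_smul_apply]

theorem norm_indicatorIco_one (c : k) : ‖indicatorIco c 1‖ = ‖c‖ := by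
  change ‖indicatorConstLp 2 (measurableSet_Ico (a := (0 : ℝ)) (b := 1)) (by simp) c‖ = _
  rw [norm_indicatorConstLp (by norm_num) (by norm_num)]
  simp

/-- The inner product is the primitive `∫ x in 0..t, ⟪f x, c⟫`, which is continuous in `t` because
an `L²` function is locally integrable. With `f` from the dense sequence, these are the test
sections of the measurable structure. -/
theorem measurable_inner_chi (c : k) (f : LTwo k) :
    Measurable fun t : PosTime => ⟪fockExp (cutIco t f), chi c t⟫_ℂ := by
  have key : ∀ t : PosTime, ⟪fockExp (cutIco t f), chi c t⟫_ℂ =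
      ∫ x in (0 : ℝ)..t, ⟪f x, c⟫_ℂ := by
    intro t
    rw [chi, inner_fockExp_fockOne, L2.inner_def, intervalIntegral.integral_of_le t.2.le,
      ← integral_Ico_eq_integral_Ioc, ← integral_indicator measurableSet_Ico]
    refine integral_congr_ae ?_
    filter_upwards [cut_coe t f, indicatorIco_coe c t] with x h1 h2
    rw [h2, show (cutIco t f : LTwo k) x = _ from h1]
    simp only [Set.indicator_apply]
    split_ifs <;> simp
  simp_rw [key]
  have hint : ∀ a b : ℝ, IntervalIntegrable (fun x => ⟪f x, c⟫_ℂ) volume a b := fun a b => by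
    have hf : LocallyIntegrable f := (Lp.memLp f).locallyIntegrable (by norm_num)
    have := (hf.integrableOn_isCompact isCompact_uIcc).intervalIntegrable (a := a) (b := b)
    exact ⟨this.1.inner_const c, this.2.inner_const c⟩
  exact ((intervalIntegral.continuous_primitive hint 0).comp continuous_subtype_val).measurable

/-! ### The space of roots -/

section separable
variable [TopologicalSpace.SeparableSpace k]

theorem isRoot_chi (c : k) : (fockPointed k).IsRoot (fockPointed k).unit (chi c) where
  measurable n := measurable_inner_chi c (denseLTwo k n)
  add s t := by
    change fockOne _ = _
    rw [← join_indicatorIco, fockOne_join]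
    rfl
  orthogonal t := inner_vacuum_fockOne _

variable (k) in
/-- The map `c ↦ χ^c` from `k` to the roots of the Fock Arveson system. -/
def chiRoot : k →ₗᵢ[ℂ] (fockPointed k).Root where
  toFun c := ⟨chi c, isRoot_chi c⟩
  map_add' c d := Subtype.ext (funext fun t => by
    change fockOneₗᵢ t (indicatorIco (c + d) t) = fockOneₗᵢ t (indicatorIco c t) +
      fockOneₗᵢ t (indicatorIco d t)
    rw [indicatorIco_add, map_add])
  map_smul' z c := Subtype.ext (funext fun t => by
    change fockOneₗᵢ t (indicatorIco (z • c) t) = z • fockOneₗᵢ t (indicatorIco c t)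
    rw [indicatorIco_smul, map_smul])
  norm_map' c := by
    rw [@norm_eq_sqrt_re_inner ℂ]
    change √(RCLike.re ⟪fockOne (indicatorIco c 1), fockOne (indicatorIco c 1)⟫_ℂ) = _
    rw [← @norm_eq_sqrt_re_inner ℂ]
    exact (norm_oneParticle _).trans (norm_indicatorIco_one c)

/-- Only time `1` has to be compared: the difference of the root and `χ^c` is again a root, and a
root vanishing at time `1` is zero. -/
theorem chiRoot_surjective [CompleteSpace k] : Function.Surjective (chiRoot k) := by
  intro a
  choose g hg using exists_rootAt_eq_fockOne a
  obtain ⟨c, hc⟩ := exists_eq_indicatorIco (g := g) fun s t => by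
    -- Injectivity of the one-particle embedding turns the addit equation for the root into the
    -- concatenation equation for `g`.
    refine (fockOneₗᵢ (k := k) _).injective ?_
    change fockOne _ = fockOne _
    rw [fockOne_join, ← hg, ← hg, ← hg, rootAt_add]
  refine ⟨c, sub_eq_zero.mp (PointedArvesonSystem.Root.eq_zero_of_apply_one _ ?_)⟩
  change fockOne (indicatorIco c 1) - rootAt a ⟨1, one_pos⟩ = 0
  rw [hg, hc, sub_self]

end separable
end Roots

end

theorem mainTheorem6 {k : Type*} [NormedAddCommGroup k] [InnerProductSpace ℂ k] [CompleteSpace k]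
    [TopologicalSpace.SeparableSpace k] :
    ∃ Φ : k ≃ₗᵢ[ℂ] (fockPointed k).Root, ∀ (c : k) (t : PosTime), Φ c t = chi c t :=
  ⟨LinearIsometryEquiv.ofSurjective (chiRoot k) chiRoot_surjective, fun _ _ => rfl⟩
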